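/- Let $S_k$ be the set of permutations of $\{1,\dots,k\}$. A pattern $p\in S_m$ occurs (consecutively) in a text $t\in S_n$ at position $i$ if $i+m-1\le n$ and $t_i t_{i+1}\cdots t_{i+m-1}$ is order-isomorphic to $p$. A search algorithm for $p$ in texts of length $n$ is a deterministic adaptive procedure that accesses symbols of an unknown $t\in S_n$ one at a time (an access to position $i$ reveals the value $t_i$; the next position may depend arbitrarily on $p$ and on the values already read) and finally reports exactly the set of positions at which $p$ occurs in $t$. Its average complexity is the mean, over all $t\in S_n$ taken equiprobable, of the number of accesses to the text; it is a lower bound for the average running time on any machine on which an access to the text costs at least one unit of time. There are constants $c,C>0$ and $m_0$ such that for all $m\ge m_0$ the following hold. 1. (Lower bound.) Let $n\ge 2m-1$, and for each $p\in S_m$ let $A_p$ be any search algorithm for $p$ in texts of length $n$. Then the average complexity, over equiprobable texts $t\in S_n$ and equiprobable patterns $p\in S_m$, satisfies $$\frac1{m!}\sum_{p\in S_m}\frac1{n!}\sum_{t\in S_n}\#\{\text{accesses of }A_p\text{ on }t\}\ \ge\ c\,\frac{n\log m}{m\log\log m}.$$ 2. (The bound is reached.) Let $n\ge m$. Then for every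 $p\in S_m$ there is a search algorithm for $p$ in texts of length $n$ whose average complexity is at most $C\,\dfrac{n\log m}{m\log\log m}$. Hence $\Theta\!\left(\frac{n\log m}{m\log\log m}\right)$ is the optimal average number of text accesses for consecutive motif matching. -/

import Mathlib

/-- The pattern `p` of length `m` occurs (consecutively) in the text `t` of length `n` at the
position `i` (positions are counted from `0`): the factor `t i, …, t (i + m - 1)` lies inside the
text and is order-isomorphic to `p`. -/
def OccursAt {m n : ℕ} (p : Equiv.Perm (Fin m)) (t : Equiv.Perm (Fin n)) (i : ℕ) : Prop :=
  ∃ h : i + m ≤ n, ∀ k l : Fin m,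
    p k < p l ↔
      t ⟨i + k, lt_of_lt_of_le (Nat.add_lt_add_left k.isLt i) h⟩ <
        t ⟨i + l, lt_of_lt_of_le (Nat.add_lt_add_left l.isLt i) h⟩

/-- A deterministic algorithm that searches texts of length `n`. It either stops and reports a
finite set of positions, or it accesses some position `i` of the text and goes on in a way that
may depend arbitrarily on the symbol found there (and thereby on all symbols read so far).
Everything except the accesses to the text is free. -/
inductive SearchAlg (n : ℕ) : Type where
  | report (s : Finset ℕ) : SearchAlg n
  | access (i : Fin n) (next : Fin n → SearchAlg n) : SearchAlg n

namespace SearchAlg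

/-- The set of positions reported on the text `t`. -/
def output {n : ℕ} (t : Equiv.Perm (Fin n)) : SearchAlg n → Finset ℕ
  | report s => s
  | access i next => output t (next (t i))

/-- The number of text accesses made on the text `t`. -/
def accesses {n : ℕ} (t : Equiv.Perm (Fin n)) : SearchAlg n → ℕ
  | report _ => 0
  | access i next => accesses t (next (t i)) + 1

/-- The algorithm searches for the pattern `p`: on every text it reports exactly the positions of
the occurrences of `p`. -/
def Searches {m n : ℕ} (A : SearchAlg n) (p : Equiv.Perm (Fin m)) : Prop :=
  ∀ (t : Equiv.Perm (Fin n)) (i : ℕ), i ∈ A.output t ↔ OccursAt p t i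

/-- The average number of text accesses, all texts (permutations of size `n`) being
equiprobable. -/
noncomputable def averageAccesses {n : ℕ} (A : SearchAlg n) : ℝ :=
  (∑ t : Equiv.Perm (Fin n), (A.accesses t : ℝ)) / (n.factorial : ℝ)

end SearchAlg

/-! Lower bound. Cut the text into segments of length 2m-1, each containing m windows, and let k be
about log m / (8 log log m). A typical pattern is `Flexible`: whatever values are prescribed at
fewer than k places of a segment, one of the m shifts of the pattern fits them approximately. Indeed
a single shift fits with probability at least about m^(-1/4), there are √m shifts that use disjoint
parts of the pattern, and the failure probability exp(-m^(1/4)/2) beats the number of prescriptions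
in a union bound (`card_not_flexible_le`).

Consider a segment in which fewer than k symbols were read and the values read are well separated.
Rescaled to the range of the pattern, these values are approximated by some shift; the wide gaps
between them leave room for the unread symbols of that window, so some text consistent with
everything read has an occurrence there (`exists_agreeing_occursAt`). Exchanging two unread symbols
of the window destroys the occurrence unseen, so the algorithm errs (`SearchAlg.Searches.card_le`).
Hence every segment either receives k reads or sees a clash, a value read too close to the border or
to an earlier value of the segment. Each read clashes with conditional probability at most 1/k, so
the mean number of clashing segments is at most 1/k times the mean number of accesses
(`SearchAlg.sum_card_clashSegments_le`). Both alternatives cost order k accesses per segment on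
average, which is order n k / m in total.

Upper bound. Treat the candidate positions in blocks of h = m/2. All windows of a block share k
consecutive positions, with k of order log m / log log m chosen so that k! ≥ m². Reading these k
symbols excludes every candidate of the block except with probability at most h/k!, so the full
check of the block costs at most one access on average
(`SearchAlg.exists_searches_averageAccesses_le`). -/

/-! ### Random permutations with some values known -/

/-- The permutations that agree with `t₀` on `Q`. -/
def agreeing {n : ℕ} (Q : Finset (Fin n)) (t₀ : Equiv.Perm (Fin n)) :
    Finset (Equiv.Perm (Fin n)) :=
  Finset.univ.filter fun t => ∀ x ∈ Q, t x = t₀ x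

section Agreeing

variable {n : ℕ} {Q : Finset (Fin n)} {t₀ t : Equiv.Perm (Fin n)}

theorem mem_agreeing : t ∈ agreeing Q t₀ ↔ ∀ x ∈ Q, t x = t₀ x := by
  simp [agreeing]

theorem agreeing_empty : agreeing ∅ t₀ = Finset.univ := by
  ext t; simp [mem_agreeing]

theorem swap_mul_apply_of_mem {y : Fin n} (hy : y ∉ Q) {v : Fin n} (hv : v ∉ Q.image t₀)
    {x : Fin n} (hx : x ∈ Q) : (Equiv.swap (t₀ y) v * t₀) x = t₀ x := by
  rw [Equiv.Perm.mul_apply]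
  apply Equiv.swap_apply_of_ne_of_ne
  · intro h
    exact hy (t₀.injective h ▸ hx)
  · rintro rfl
    exact hv (Finset.mem_image_of_mem _ hx)

theorem filter_agreeing {y : Fin n} (hy : y ∉ Q) {v : Fin n} (hv : v ∉ Q.image t₀) :
    (agreeing Q t₀).filter (fun t => t y = v) =
      agreeing (insert y Q) (Equiv.swap (t₀ y) v * t₀) := by
  ext t
  simp only [Finset.mem_filter, mem_agreeing, Finset.forall_mem_insert]
  have h1 : (Equiv.swap (t₀ y) v * t₀) y = v := by simp
  rw [h1, and_comm]
  refine and_congr_right fun _ => forall₂_congr fun x hx => ?_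
  rw [swap_mul_apply_of_mem hy hv hx]

/-- Conditioning on the value v at a new position y: the class splits according to the unused
values, and `swap (t₀ y) v * t₀` represents the part with value v. -/
theorem sum_agreeing {M : Type*} [AddCommMonoid M] {y : Fin n} (hy : y ∉ Q)
    (F : Equiv.Perm (Fin n) → M) :
    ∑ t ∈ agreeing Q t₀, F t =
      ∑ v ∈ (Q.image t₀)ᶜ, ∑ t ∈ agreeing (insert y Q) (Equiv.swap (t₀ y) v * t₀), F t := by
  rw [← Finset.sum_fiberwise_of_maps_to (t := (Q.image t₀)ᶜ) (g := fun t => t y)]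
  · refine Finset.sum_congr rfl fun v hv => ?_
    rw [filter_agreeing hy (Finset.mem_compl.mp hv)]
  · intro t ht
    rw [mem_agreeing] at ht
    simp only [Finset.mem_compl, Finset.mem_image, not_exists, not_and]
    intro x hx h
    rw [← ht x hx] at h
    exact hy (t.injective h ▸ hx)

theorem card_compl_image : ((Q.image t₀)ᶜ).card = n - Q.card := by
  rw [Finset.card_compl, Finset.card_image_of_injective _ t₀.injective, Fintype.card_fin]

theorem card_agreeing (Q : Finset (Fin n)) (t₀ : Equiv.Perm (Fin n)) :
    (agreeing Q t₀).card = (n - Q.card).factorial := by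
  induction h : n - Q.card generalizing Q t₀ with
  | zero =>
    have hQ : Q = Finset.univ := by
      rw [← Finset.card_eq_iff_eq_univ, Fintype.card_fin]
      have := Q.card_le_univ
      rw [Fintype.card_fin] at this
      omega
    have : agreeing Q t₀ = {t₀} := by
      ext t
      simp [mem_agreeing, hQ, Equiv.ext_iff]
    simp [this]
  | succ d ih =>
    obtain ⟨y, hy⟩ : ∃ y, y ∉ Q := by
      by_contra! hc
      have hQ : Q = Finset.univ := by ext; simp [hc]
      rw [hQ, Finset.card_univ, Fintype.card_fin] at h
      omega
    rw [Finset.card_eq_sum_ones, sum_agreeing hy]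
    simp only [← Finset.card_eq_sum_ones]
    rw [Finset.sum_congr rfl fun v _ => ih (insert y Q) _ (by
      rw [Finset.card_insert_of_notMem hy]; omega)]
    rw [Finset.sum_const, card_compl_image, h, smul_eq_mul, Nat.factorial_succ]

theorem card_agreeing_insert {y : Fin n} (hy : y ∉ Q) (t₁ : Equiv.Perm (Fin n)) :
    (n - Q.card) * (agreeing (insert y Q) t₁).card = (agreeing Q t₀).card := by
  have h : (insert y Q).card ≤ n := by simpa using (insert y Q).card_le_univ
  rw [Finset.card_insert_of_notMem hy] at h
  rw [card_agreeing, card_agreeing, Finset.card_insert_of_notMem hy,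
    show n - Q.card = (n - (Q.card + 1)) + 1 by omega, Nat.factorial_succ]

/-- Law of total probability: `G` is a disjoint union of classes of agreement on `Q`, so a bound
valid in each class is valid in `G`. -/
theorem card_filter_le_of_agreeing {G : Finset (Equiv.Perm (Fin n))}
    (hG : ∀ t ∈ G, agreeing Q t ⊆ G) {P : Equiv.Perm (Fin n) → Prop} {_ : DecidablePred P} {r : ℝ}
    (h : ∀ t ∈ G, (((agreeing Q t).filter P).card : ℝ) ≤ r * (agreeing Q t).card) :
    ((G.filter P).card : ℝ) ≤ r * G.card := by
  let ρ : Equiv.Perm (Fin n) → Q → Fin n := fun t x => t x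
  have hfib : ∀ t ∈ G, G.filter (fun s => ρ s = ρ t) = agreeing Q t := by
    intro t ht
    ext s
    simp only [Finset.mem_filter, mem_agreeing, ρ, funext_iff, Subtype.forall]
    refine ⟨fun hs => hs.2, fun hs => ⟨hG t ht (mem_agreeing.mpr hs), hs⟩⟩
  have h1 := Finset.card_eq_sum_card_fiberwise (f := ρ) (s := G) (t := G.image ρ)
    (fun t ht => Finset.mem_image_of_mem ρ ht)
  have h2 := Finset.card_eq_sum_card_fiberwise (f := ρ) (s := G.filter P) (t := G.image ρ)
    (fun t ht => Finset.mem_image_of_mem ρ (Finset.mem_filter.mp ht).1)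
  rw [h1, h2]
  push_cast
  rw [Finset.mul_sum]
  refine Finset.sum_le_sum fun b hb => ?_
  obtain ⟨t, ht, rfl⟩ := Finset.mem_image.mp hb
  rw [Finset.filter_filter, Finset.filter_congr (fun s _ => and_comm (a := P s)),
    ← Finset.filter_filter, hfib t ht]
  exact h t ht

/-- Reveal the positions of `D` one by one. At most `Q.card + D.card` values are ever used up, so at
each step at least τ of at most n equally likely values are in `T y`. -/
theorem le_card_filter_forall_mem {D : Finset (Fin n)} (T : Fin n → Finset (Fin n)) (τ : ℕ)
    (hDQ : Disjoint D Q) (hT : ∀ y ∈ D, τ + Q.card + D.card ≤ (T y).card) :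
    τ ^ D.card * (agreeing Q t₀).card ≤
      n ^ D.card * ((agreeing Q t₀).filter fun t => ∀ y ∈ D, t y ∈ T y).card := by
  induction D using Finset.induction_on generalizing Q t₀ with
  | empty => simp
  | insert y D hyD ih =>
    rw [Finset.disjoint_insert_left] at hDQ
    obtain ⟨hyQ, hDQ⟩ := hDQ
    rw [Finset.card_insert_of_notMem hyD] at hT ⊢
    set e := (agreeing (insert y Q) t₀).card with he
    have hE : (agreeing Q t₀).card = (n - Q.card) * e := (card_agreeing_insert hyQ t₀).symm
    have hstep : ∀ v, τ ^ D.card * e ≤ n ^ D.card *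
        ((agreeing (insert y Q) (Equiv.swap (t₀ y) v * t₀)).filter
          fun t => ∀ y ∈ D, t y ∈ T y).card := by
      intro v
      have := ih (Q := insert y Q) (t₀ := Equiv.swap (t₀ y) v * t₀)
        (by rw [Finset.disjoint_insert_right]; exact ⟨hyD, hDQ⟩)
        (fun z hz => by
          rw [Finset.card_insert_of_notMem hyQ]
          have := hT z (Finset.mem_insert_of_mem hz)
          omega)
      rwa [card_agreeing, Finset.card_insert_of_notMem hyQ, ← Finset.card_insert_of_notMem hyQ,
        ← card_agreeing (insert y Q) t₀] at this
    have hV : τ ≤ (T y \ Q.image t₀).card := by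
      have h1 := Finset.le_card_sdiff (Q.image t₀) (T y)
      have h2 := hT y (Finset.mem_insert_self _ _)
      rw [Finset.card_image_of_injective _ t₀.injective] at h1
      omega
    have hlow : ∑ v ∈ T y \ Q.image t₀,
          ((agreeing (insert y Q) (Equiv.swap (t₀ y) v * t₀)).filter
          fun t => ∀ y ∈ D, t y ∈ T y).card ≤
        ((agreeing Q t₀).filter fun t => ∀ z ∈ insert y D, t z ∈ T z).card := by
      rw [Finset.card_filter, sum_agreeing hyQ]
      simp only [← Finset.card_filter]
      calc _ ≤ ∑ v ∈ T y \ Q.image t₀,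
          ((agreeing (insert y Q) (Equiv.swap (t₀ y) v * t₀)).filter
            fun t => ∀ z ∈ insert y D, t z ∈ T z).card := by
            refine Finset.sum_le_sum fun v hv => Finset.card_le_card fun t ht => ?_
            rw [Finset.mem_filter] at ht ⊢
            refine ⟨ht.1, ?_⟩
            rw [Finset.forall_mem_insert]
            refine ⟨?_, ht.2⟩
            have := mem_agreeing.mp ht.1 y (Finset.mem_insert_self _ _)
            rw [this, Equiv.Perm.mul_apply, Equiv.swap_apply_left]
            exact (Finset.mem_sdiff.mp hv).1
        _ ≤ _ := Finset.sum_le_sum_of_subset fun v hv =>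
            Finset.mem_compl.mpr (Finset.mem_sdiff.mp hv).2
    calc τ ^ (D.card + 1) * (agreeing Q t₀).card
        = (n - Q.card) * (τ * (τ ^ D.card * e)) := by rw [hE]; ring
      _ ≤ n * ((T y \ Q.image t₀).card * (τ ^ D.card * e)) :=
          Nat.mul_le_mul (Nat.sub_le _ _) (Nat.mul_le_mul_right _ hV)
      _ = n * ∑ v ∈ T y \ Q.image t₀, τ ^ D.card * e := by
          rw [Finset.sum_const, smul_eq_mul]
      _ ≤ n * ∑ v ∈ T y \ Q.image t₀, n ^ D.card *
          ((agreeing (insert y Q) (Equiv.swap (t₀ y) v * t₀)).filter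
          fun t => ∀ y ∈ D, t y ∈ T y).card :=
          Nat.mul_le_mul_left _ (Finset.sum_le_sum fun v _ => hstep v)
      _ ≤ n * (n ^ D.card *
          ((agreeing Q t₀).filter fun t => ∀ z ∈ insert y D, t z ∈ T z).card) := by
          rw [← Finset.mul_sum]
          exact Nat.mul_le_mul_left _ (Nat.mul_le_mul_left _ hlow)
      _ = _ := by ring

/-- Permutation values are not independent, but the size reserve `k * I.card` absorbs the values
used by earlier trials: conditionally on these, each trial still succeeds with probability at least
(τ/n)^k, and the failure probabilities multiply. -/
theorem card_filter_forall_exists_notMem_le {k τ : ℕ} {I : Finset ℕ} (D : ℕ → Finset (Fin n))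
    (T : ℕ → Fin n → Finset (Fin n)) (hτ : τ ≤ n) (hk : ∀ i ∈ I, (D i).card ≤ k)
    (hDQ : ∀ i ∈ I, Disjoint (D i) Q)
    (hD : ∀ i ∈ I, ∀ j ∈ I, i ≠ j → Disjoint (D i) (D j))
    (hT : ∀ i ∈ I, ∀ y ∈ D i, τ + Q.card + k * I.card ≤ (T i y).card) :
    (((agreeing Q t₀).filter fun t => ∀ i ∈ I, ∃ y ∈ D i, t y ∉ T i y).card : ℝ) ≤
      (1 - ((τ : ℝ) / n) ^ k) ^ I.card * (agreeing Q t₀).card := by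
  have hq0 : (0 : ℝ) ≤ (τ : ℝ) / n := by positivity
  have hq1 : (τ : ℝ) / n ≤ 1 := div_le_one_of_le₀ (by exact_mod_cast hτ) (by positivity)
  have hq : 0 ≤ 1 - ((τ : ℝ) / n) ^ k := sub_nonneg.mpr (pow_le_one₀ hq0 hq1)
  induction I using Finset.induction_on generalizing Q t₀ with
  | empty => simp
  | insert i I hi ih =>
    rw [Finset.card_insert_of_notMem hi] at hT ⊢
    simp only [Finset.forall_mem_insert] at hk hDQ hT
    have hDi : ∀ j ∈ I, Disjoint (D j) (D i) := fun j hj =>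
      hD j (Finset.mem_insert_of_mem hj) i (Finset.mem_insert_self _ _)
        (fun h => hi (h ▸ hj))
    set G := (agreeing Q t₀).filter fun t => ∃ y ∈ D i, t y ∉ T i y with hG
    have hsplit : ((agreeing Q t₀).filter
        fun t => ∀ j ∈ insert i I, ∃ y ∈ D j, t y ∉ T j y) =
        G.filter fun t => ∀ j ∈ I, ∃ y ∈ D j, t y ∉ T j y := by
      ext t
      simp only [hG, Finset.mem_filter, Finset.forall_mem_insert, and_assoc]
    have hcard : (Q ∪ D i).card ≤ Q.card + k :=
      (Finset.card_union_le _ _).trans (Nat.add_le_add_left hk.1 _)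
    have h1 : ((G.filter fun t => ∀ j ∈ I, ∃ y ∈ D j, t y ∉ T j y).card : ℝ) ≤
        (1 - ((τ : ℝ) / n) ^ k) ^ I.card * G.card := by
      refine card_filter_le_of_agreeing (Q := Q ∪ D i) ?_ ?_
      · intro t ht s hs
        rw [hG, Finset.mem_filter, mem_agreeing] at ht ⊢
        rw [mem_agreeing] at hs
        refine ⟨fun x hx => (hs x (Finset.mem_union_left _ hx)).trans (ht.1 x hx), ?_⟩
        obtain ⟨y, hy, hyT⟩ := ht.2
        exact ⟨y, hy, by rwa [hs y (Finset.mem_union_right _ hy)]⟩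
      · intro t _
        refine ih hk.2 ?_ ?_ ?_
        · intro j hj
          rw [Finset.disjoint_union_right]
          exact ⟨hDQ.2 j hj, hDi j hj⟩
        · intro a ha b hb
          exact hD a (Finset.mem_insert_of_mem ha) b (Finset.mem_insert_of_mem hb)
        · intro j hj y hy
          have := hT.2 j hj y hy
          rw [mul_add, mul_one] at this
          omega
    have h2 : (G.card : ℝ) ≤ (1 - ((τ : ℝ) / n) ^ k) * (agreeing Q t₀).card := by
      have h3 := le_card_filter_forall_mem (Q := Q) (t₀ := t₀) (T i) τ hDQ.1 (fun y hy => by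
        have := hT.1 y hy
        rw [mul_add, mul_one] at this
        have := hk.1
        omega)
      have h4 : G.card + ((agreeing Q t₀).filter fun t => ∀ y ∈ D i, t y ∈ T i y).card =
          (agreeing Q t₀).card := by
        rw [← Finset.card_filter_add_card_filter_not (s := agreeing Q t₀)
          (fun t => ∀ y ∈ D i, t y ∈ T i y), hG, add_comm]
        simp only [not_forall, exists_prop]
      have h5 : ((τ : ℝ) / n) ^ k * (agreeing Q t₀).card ≤
          ((agreeing Q t₀).filter fun t => ∀ y ∈ D i, t y ∈ T i y).card := by
        rcases Nat.eq_zero_or_pos n with rfl | hn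
        · have hD0 : D i = ∅ := by ext x; exact x.elim0
          rw [hD0]
          simp only [Finset.notMem_empty, IsEmpty.forall_iff, Finset.filter_true]
          exact mul_le_of_le_one_left (by positivity) (pow_le_one₀ hq0 hq1)
        have hn' : (0 : ℝ) < n := by exact_mod_cast hn
        calc ((τ : ℝ) / n) ^ k * (agreeing Q t₀).card
            ≤ ((τ : ℝ) / n) ^ (D i).card * (agreeing Q t₀).card :=
              mul_le_mul_of_nonneg_right (pow_le_pow_of_le_one hq0 hq1 hk.1) (by positivity)
          _ ≤ _ := by
              rw [div_pow, div_mul_eq_mul_div, div_le_iff₀ (by positivity), mul_comm _ ((n : ℝ) ^ _)]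
              exact_mod_cast h3
      have h6 : (G.card : ℝ) + ((agreeing Q t₀).filter fun t => ∀ y ∈ D i, t y ∈ T i y).card =
          (agreeing Q t₀).card := by exact_mod_cast h4
      linarith
    rw [hsplit]
    calc _ ≤ (1 - ((τ : ℝ) / n) ^ k) ^ I.card * G.card := h1
      _ ≤ (1 - ((τ : ℝ) / n) ^ k) ^ I.card *
          ((1 - ((τ : ℝ) / n) ^ k) * (agreeing Q t₀).card) :=
          mul_le_mul_of_nonneg_left h2 (pow_nonneg hq _)
      _ = _ := by ring

end Agreeing

/-! ### Most patterns are flexible -/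

/-- Whatever fewer than `k` positions are fixed and whatever values are prescribed there, some
shift of `p` by less than `m` takes values within `ε` of the prescribed ones. -/
def Flexible {m : ℕ} (k ε : ℕ) (p : Equiv.Perm (Fin m)) : Prop :=
  ∀ S : Finset ℕ, S.card < k → ∀ c : ℕ → ℕ, (∀ x, c x < m) → ∃ i < m, ∀ y : Fin m,
    i + (y : ℕ) ∈ S → (p y : ℕ) ≤ c (i + y) + ε ∧ c (i + y) ≤ (p y : ℕ) + ε

theorem exists_shifts_disjoint (S : Finset ℕ) {k m : ℕ} (hS : S.card ≤ k) (N : ℕ)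
    (hN : N * (k ^ 2 + 1) ≤ m) :
    ∃ I ⊆ Finset.range m, I.card = N ∧
      ∀ i ∈ I, ∀ j ∈ I, i ≠ j → ∀ y, i + y ∈ S → j + y ∉ S := by
  induction N with
  | zero => exact ⟨∅, by simp, by simp, by simp⟩
  | succ N ih =>
    obtain ⟨I, hIm, hIc, hI⟩ := ih (le_trans (Nat.mul_le_mul_right _ (Nat.le_succ _)) hN)
    -- A conflict of j with i forces j = i + s - s' with s, s' in `S`; each chosen shift thus rules
    -- out at most k² others and itself.
    let F := I ∪ (I ×ˢ S ×ˢ S).image fun a => a.1 + a.2.1 - a.2.2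
    have hF : F.card < m := by
      calc F.card ≤ I.card + (I ×ˢ S ×ˢ S).card :=
            (Finset.card_union_le _ _).trans (Nat.add_le_add_left Finset.card_image_le _)
        _ = N + N * (S.card * S.card) := by rw [Finset.card_product, Finset.card_product, hIc]
        _ ≤ N + N * (k * k) :=
            Nat.add_le_add_left (Nat.mul_le_mul_left _ (Nat.mul_le_mul hS hS)) _
        _ < (N + 1) * (k ^ 2 + 1) := by nlinarith [Nat.zero_le (k * k)]
        _ ≤ m := hN
    obtain ⟨j, hj, hjF⟩ : ∃ j ∈ Finset.range m, j ∉ F := by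
      by_contra! h
      have := Finset.card_le_card (show Finset.range m ⊆ F from h)
      rw [Finset.card_range] at this
      omega
    simp only [F, Finset.mem_union, Finset.mem_image, Finset.mem_product, Prod.exists, not_or,
      not_exists, not_and] at hjF
    obtain ⟨hjI, hjF⟩ := hjF
    have key : ∀ i ∈ I, ∀ y, i + y ∈ S → j + y ∉ S := fun i hi y h1 h2 =>
      hjF i (j + y) (i + y) ⟨hi, h2, h1⟩ (by omega)
    refine ⟨insert j I, Finset.insert_subset hj hIm, ?_, ?_⟩
    · rw [Finset.card_insert_of_notMem hjI, hIc]
    · intro a ha b hb hab y h1 h2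
      rcases Finset.mem_insert.mp ha with rfl | ha'
      · rcases Finset.mem_insert.mp hb with rfl | hb'
        · exact hab rfl
        · exact key b hb' y h2 h1
      · rcases Finset.mem_insert.mp hb with rfl | hb'
        · exact key a ha' y h1 h2
        · exact hI a ha' b hb' hab y h1 h2

/-- The interval around c may be cut off by the border, but one of its halves, endpoint c included,
fits. -/
theorem card_near_ge {m ε c : ℕ} (hε : 2 * ε + 1 ≤ m) (hc : c < m) :
    ε + 1 ≤ (Finset.univ.filter fun v : Fin m => (v : ℕ) ≤ c + ε ∧ c ≤ (v : ℕ) + ε).card := by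
  have hsub : ∀ a : ℕ, (∀ x ∈ Finset.Icc a (a + ε), x < m ∧ x ≤ c + ε ∧ c ≤ x + ε) → ε + 1 ≤
      (Finset.univ.filter fun v : Fin m => (v : ℕ) ≤ c + ε ∧ c ≤ (v : ℕ) + ε).card := by
    intro a ha
    have h1 : (Finset.Icc a (a + ε)).card = ε + 1 := by rw [Nat.card_Icc]; omega
    rw [← h1, ← Finset.card_map Fin.valEmbedding]
    refine Finset.card_le_card fun x hx => ?_
    obtain ⟨h2, h3⟩ := ha x hx
    simp only [Finset.mem_map, Finset.mem_filter, Finset.mem_univ, true_and]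
    exact ⟨⟨x, h2⟩, h3, rfl⟩
  rcases le_total ε c with h | h
  · refine hsub (c - ε) fun x hx => ?_
    rw [Finset.mem_Icc] at hx
    omega
  · refine hsub c fun x hx => ?_
    rw [Finset.mem_Icc] at hx
    omega

/-- N shifts meet `S` in pairwise disjoint sets of arguments of p, so they act as successive trials;
k N values are set aside for those used by earlier trials. -/
theorem card_forall_shift_far_le {m k ε N τ : ℕ} (hN : N * (k ^ 2 + 1) ≤ m)
    (hε : 2 * ε + 1 ≤ m) (hτ : τ + k * N ≤ ε + 1) (S : Finset ℕ) (hS : S.card ≤ k) (c : ℕ → ℕ)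
    (hc : ∀ x, c x < m) :
    ((Finset.univ.filter fun p : Equiv.Perm (Fin m) => ∀ i < m, ∃ y : Fin m, i + (y : ℕ) ∈ S ∧
      ¬((p y : ℕ) ≤ c (i + y) + ε ∧ c (i + y) ≤ (p y : ℕ) + ε)).card : ℝ) ≤
      (1 - ((τ : ℝ) / m) ^ k) ^ N * m.factorial := by
  obtain ⟨I, hIm, hIc, hI⟩ := exists_shifts_disjoint S hS N hN
  have h := card_filter_forall_exists_notMem_le (n := m) (Q := ∅) (t₀ := 1) (k := k) (τ := τ)
    (I := I) (fun i => Finset.univ.filter fun y : Fin m => i + (y : ℕ) ∈ S)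
    (fun i y => Finset.univ.filter fun v : Fin m =>
      (v : ℕ) ≤ c (i + y) + ε ∧ c (i + y) ≤ (v : ℕ) + ε)
    (by omega)
    (fun i _ => by
      rw [← Finset.card_map Fin.valEmbedding, ← Finset.card_map (addLeftEmbedding i)]
      refine le_trans (Finset.card_le_card fun x hx => ?_) hS
      simp only [Finset.mem_map, Finset.mem_filter, Finset.mem_univ, true_and] at hx
      obtain ⟨_, ⟨y, hy, rfl⟩, rfl⟩ := hx
      exact hy)
    (fun i _ => Finset.disjoint_empty_right _)
    (fun i hi j hj hij => by
      rw [Finset.disjoint_filter]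
      exact fun y _ h => hI i hi j hj hij y h)
    (fun i _ y _ => by
      rw [Finset.card_empty, hIc]
      exact le_trans (by omega) (card_near_ge hε (hc _)))
  rw [hIc, agreeing_empty, Finset.card_univ, Fintype.card_perm, Fintype.card_fin] at h
  refine le_trans ?_ h
  norm_cast
  refine Finset.card_le_card fun p hp => ?_
  simp only [Finset.mem_filter, Finset.mem_univ, true_and] at hp ⊢
  exact fun i hi => hp i (Finset.mem_range.mp (hIm hi))

theorem exists_fin_image_eq {α : Type*} [DecidableEq α] {k : ℕ} (S : Finset α) (hS : S.card ≤ k)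
    (hne : S.Nonempty) : ∃ w : Fin k → α, Finset.univ.image w = S := by
  obtain ⟨e⟩ : Nonempty (S ↪ Fin k) := Function.Embedding.nonempty_of_card_le (by simpa using hS)
  have : Nonempty S := hne.to_subtype
  refine ⟨fun j => (Function.invFun e j : S), ?_⟩
  ext x
  simp only [Finset.mem_image, Finset.mem_univ, true_and]
  constructor
  · rintro ⟨j, rfl⟩
    exact (Function.invFun e j).2
  · intro hx
    obtain ⟨j, hj⟩ := Function.invFun_surjective e.injective ⟨x, hx⟩
    exact ⟨j, by rw [hj]⟩

-- Union bound over the prescriptions: a place below 2m and a value below m for each of k indices.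
open Classical in
theorem card_not_flexible_le {m k ε N τ : ℕ} (hN : N * (k ^ 2 + 1) ≤ m) (hk : 0 < k)
    (hε : 2 * ε + 1 ≤ m) (hτ : τ + k * N ≤ ε + 1) :
    ((Finset.univ.filter fun p : Equiv.Perm (Fin m) => ¬Flexible k ε p).card : ℝ) ≤
      (2 * m * m : ℝ) ^ k * (1 - ((τ : ℝ) / m) ^ k) ^ N * m.factorial := by
  have : Nonempty (Fin k) := ⟨⟨0, hk⟩⟩
  let c : (Fin k → Fin (2 * m)) × (Fin k → Fin m) → ℕ → ℕ := fun a x =>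
    a.2 (Function.invFun (fun j => (a.1 j : ℕ)) x)
  let S : (Fin k → Fin (2 * m)) × (Fin k → Fin m) → Finset ℕ := fun a =>
    Finset.univ.image fun j => (a.1 j : ℕ)
  let B : (Fin k → Fin (2 * m)) × (Fin k → Fin m) → Finset (Equiv.Perm (Fin m)) := fun a =>
    Finset.univ.filter fun p : Equiv.Perm (Fin m) => ∀ i < m, ∃ y : Fin m, i + (y : ℕ) ∈ S a ∧
      ¬((p y : ℕ) ≤ c a (i + y) + ε ∧ c a (i + y) ≤ (p y : ℕ) + ε)
  have hsub : (Finset.univ.filter fun p : Equiv.Perm (Fin m) => ¬Flexible k ε p) ⊆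
      Finset.univ.biUnion B := by
    intro p hp
    replace hp := (Finset.mem_filter.mp hp).2
    unfold Flexible at hp
    push Not at hp
    obtain ⟨S₀, hS₀, c₀, hc₀, h⟩ := hp
    -- The filler 2m-1 makes the set nonempty, so that `Fin k` can enumerate it with repetitions. It
    -- is harmless: i + y ≤ 2m-2 for i, y < m, and `S₀` has fewer than k elements.
    let S₁ := insert (2 * m - 1) (S₀.filter (· < 2 * m - 1))
    have hS₁ : S₁.card ≤ k := by
      have h1 := Finset.card_insert_le (2 * m - 1) (S₀.filter (· < 2 * m - 1))
      have h2 := Finset.card_filter_le S₀ (· < 2 * m - 1)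
      exact h1.trans (by omega)
    obtain ⟨w, hw⟩ := exists_fin_image_eq S₁ hS₁ (Finset.insert_nonempty _ _)
    have hwS : ∀ j, w j ∈ S₁ := fun j => hw ▸ Finset.mem_image_of_mem w (Finset.mem_univ j)
    have hw2 : ∀ j, w j < 2 * m := fun j => by
      rcases Finset.mem_insert.mp (hwS j) with h1 | h1
      · omega
      · have := (Finset.mem_filter.mp h1).2
        omega
    let a : (Fin k → Fin (2 * m)) × (Fin k → Fin m) :=
      (fun j => ⟨w j, hw2 j⟩, fun j => ⟨c₀ (w j), hc₀ _⟩)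
    have hSa : S a = S₁ := hw
    have hca : ∀ x ∈ S₁, c a x = c₀ x := by
      intro x hx
      rw [← hw] at hx
      have : w (Function.invFun w x) = x := Function.invFun_eq (by simpa using hx)
      change c₀ (w (Function.invFun w x)) = c₀ x
      rw [this]
    refine Finset.mem_biUnion.mpr ⟨a, Finset.mem_univ _, ?_⟩
    simp only [B, Finset.mem_filter, Finset.mem_univ, true_and, hSa]
    intro i hi
    obtain ⟨y, hyS, hy⟩ := h i hi
    have hmem : i + (y : ℕ) ∈ S₁ :=
      Finset.mem_insert_of_mem (Finset.mem_filter.mpr ⟨hyS, by omega⟩)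
    refine ⟨y, hmem, ?_⟩
    rw [hca _ hmem]
    exact fun h => absurd (hy h.1) (not_lt.mpr h.2)
  have hB : ∀ a, ((B a).card : ℝ) ≤ (1 - ((τ : ℝ) / m) ^ k) ^ N * m.factorial := fun a =>
    card_forall_shift_far_le hN hε hτ (S a)
      (Finset.card_image_le.trans (by simp)) (c a) (fun x => (a.2 _).isLt)
  calc _ ≤ ((Finset.univ.biUnion B).card : ℝ) := by exact_mod_cast Finset.card_le_card hsub
    _ ≤ ∑ a, ((B a).card : ℝ) := by exact_mod_cast Finset.card_biUnion_le
    _ ≤ ∑ a : (Fin k → Fin (2 * m)) × (Fin k → Fin m),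
        (1 - ((τ : ℝ) / m) ^ k) ^ N * (m.factorial : ℝ) := Finset.sum_le_sum fun a _ => hB a
    _ = _ := by
      simp only [Finset.sum_const, Finset.card_univ, Fintype.card_prod, Fintype.card_pi,
        Fintype.card_fin, Finset.prod_const, nsmul_eq_mul]
      push_cast
      rw [← mul_pow]
      ring

/-! ### Clashes along the run of an algorithm -/

namespace SearchAlg

/-- The set of positions accessed on the text `t`. -/
def readSet {n : ℕ} (t : Equiv.Perm (Fin n)) : SearchAlg n → Finset (Fin n)
  | report _ => ∅
  | access i next => insert i (readSet t (next (t i)))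

theorem output_congr {n : ℕ} {t t' : Equiv.Perm (Fin n)} (A : SearchAlg n)
    (h : ∀ x ∈ A.readSet t, t' x = t x) : A.output t' = A.output t := by
  induction A with
  | report s => rfl
  | access i next ih =>
    simp only [readSet, Finset.forall_mem_insert] at h
    simp only [output, h.1]
    exact ih _ h.2

theorem card_readSet_le {n : ℕ} (t : Equiv.Perm (Fin n)) (A : SearchAlg n) :
    (A.readSet t).card ≤ A.accesses t := by
  induction A with
  | report s => simp [readSet]
  | access i next ih => exact (Finset.card_insert_le _ _).trans (Nat.succ_le_succ (ih _))

/-- The value `v`, read at the position `i` when the positions in `Q` are known, lies within `g`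
of the border of the range of values or of a known value of the same segment of length `l`; this
is recorded only while fewer than `k` positions of the segment and at most half of all positions
are known. -/
def Clashes {n : ℕ} (k g l : ℕ) (Q : Finset (Fin n)) (t : Equiv.Perm (Fin n)) (i v : Fin n) :
    Prop :=
  (Q.filter fun x : Fin n => (x : ℕ) / l = (i : ℕ) / l).card < k ∧ 2 * Q.card ≤ n ∧
    ((v : ℕ) < g ∨ n < (v : ℕ) + g ∨
      ∃ x ∈ Q, (x : ℕ) / l = (i : ℕ) / l ∧ (v : ℕ) < (t x : ℕ) + g ∧ (t x : ℕ) < (v : ℕ) + g)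

open Classical in
/-- The segments of length `l` in which a clash happens on the text `t`, the positions in `Q`
being known at the beginning. -/
noncomputable def clashSegments {n : ℕ} (k g l : ℕ) (t : Equiv.Perm (Fin n)) :
    SearchAlg n → Finset (Fin n) → Finset ℕ
  | report _, _ => ∅
  | access i next, Q =>
    if i ∉ Q ∧ Clashes k g l Q t i (t i) then
      insert ((i : ℕ) / l) (clashSegments k g l t (next (t i)) (insert i Q))
    else clashSegments k g l t (next (t i)) (insert i Q)

/-- The values of `t` at the positions of `Q` in the segment `s` are at distance at least `g` from
one another and from the border. -/
def SpreadOn {n : ℕ} (g l s : ℕ) (t : Equiv.Perm (Fin n)) (Q : Finset (Fin n)) : Prop :=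
  ∀ x ∈ Q, (x : ℕ) / l = s → (g ≤ (t x : ℕ) ∧ (t x : ℕ) + g ≤ n) ∧
    ∀ y ∈ Q, (y : ℕ) / l = s → x ≠ y →
      (t x : ℕ) + g ≤ (t y : ℕ) ∨ (t y : ℕ) + g ≤ (t x : ℕ)

/-- The set of known positions only grows, so the two cut-offs in `Clashes` hold at every read if
they hold at the end; then no loss of spread in the segment goes unrecorded. -/
theorem spreadOn_union_readSet {n k g l s : ℕ} (t : Equiv.Perm (Fin n)) (A : SearchAlg n)
    (Q : Finset (Fin n)) (hs : s ∉ A.clashSegments k g l t Q)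
    (hk : ((Q ∪ A.readSet t).filter fun x : Fin n => (x : ℕ) / l = s).card < k)
    (hn : 2 * (Q ∪ A.readSet t).card ≤ n) (hQ : SpreadOn g l s t Q) :
    SpreadOn g l s t (Q ∪ A.readSet t) := by
  induction A generalizing Q with
  | report _ => simpa [readSet] using hQ
  | access i next ih =>
    have hU : Q ∪ (access i next).readSet t = insert i Q ∪ (next (t i)).readSet t := by
      rw [readSet, Finset.union_insert, Finset.insert_union]
    rw [hU] at hk hn ⊢
    have hQsub : Q ⊆ insert i Q ∪ (next (t i)).readSet t :=
      (Finset.subset_insert _ _).trans Finset.subset_union_left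
    have hs' : s ∉ (next (t i)).clashSegments k g l t (insert i Q) ∧
        (i ∉ Q ∧ Clashes k g l Q t i (t i) → s ≠ (i : ℕ) / l) := by
      rw [clashSegments] at hs
      split_ifs at hs with h
      · rw [Finset.mem_insert, not_or] at hs
        exact ⟨hs.2, fun _ => hs.1⟩
      · exact ⟨hs, fun h' => absurd h' h⟩
    refine ih _ _ hs'.1 hk hn ?_
    by_cases hi : i ∈ Q
    · rwa [Finset.insert_eq_of_mem hi]
    by_cases his : (i : ℕ) / l = s
    · have hcl : ¬Clashes k g l Q t i (t i) := fun h => hs'.2 ⟨hi, h⟩ his.symm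
      have h1 : (Q.filter fun x : Fin n => (x : ℕ) / l = (i : ℕ) / l).card < k := by
        rw [his]
        exact (Finset.card_le_card (Finset.filter_subset_filter _ hQsub)).trans_lt hk
      have h2 : 2 * Q.card ≤ n :=
        (Nat.mul_le_mul_left 2 (Finset.card_le_card hQsub)).trans hn
      simp only [Clashes, h1, h2, true_and, not_or, not_exists, not_and, not_lt] at hcl
      obtain ⟨hc1, hc2, hc3⟩ := hcl
      intro x hx hxs
      rcases Finset.mem_insert.mp hx with rfl | hx'
      · refine ⟨⟨hc1, hc2⟩, fun y hy hys hxy => ?_⟩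
        have hy' := Finset.mem_of_mem_insert_of_ne hy hxy.symm
        have := hc3 y hy' (hys.trans his.symm)
        omega
      · refine ⟨(hQ x hx' hxs).1, fun y hy hys hxy => ?_⟩
        rcases Finset.mem_insert.mp hy with rfl | hy'
        · have := hc3 x hx' (hxs.trans his.symm)
          omega
        · exact (hQ x hx' hxs).2 y hy' hys hxy
    · intro x hx hxs
      have hx' := Finset.mem_of_mem_insert_of_ne hx (fun h => his (h ▸ hxs))
      refine ⟨(hQ x hx' hxs).1, fun y hy hys hxy => ?_⟩
      exact (hQ x hx' hxs).2 y
        (Finset.mem_of_mem_insert_of_ne hy (fun h => his (h ▸ hys))) hys hxy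

theorem card_near_le {n : ℕ} (g a : ℕ) :
    (Finset.univ.filter fun v : Fin n => (v : ℕ) < a + g ∧ a < (v : ℕ) + g).card ≤ 2 * g := by
  rw [← Finset.card_map Fin.valEmbedding]
  calc _ ≤ (Finset.Ico (a - g) (a + g)).card := by
        refine Finset.card_le_card fun x hx => ?_
        simp only [Finset.mem_map, Finset.mem_filter, Finset.mem_univ, true_and] at hx
        obtain ⟨v, hv, rfl⟩ := hx
        simp only [Fin.valEmbedding_apply, Finset.mem_Ico]
        omega
    _ ≤ 2 * g := by rw [Nat.card_Ico]; omega

-- The borders and the fewer than k known values of the segment spoil at most 2g + 2gk values, while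
-- at least n/2 values are unused.
open Classical in
theorem card_clashes_le {n k g l : ℕ} (Q : Finset (Fin n)) (t : Equiv.Perm (Fin n)) (i : Fin n)
    (h : 4 * k * (k + 1) * g ≤ n) :
    k * (Finset.univ.filter fun v => Clashes k g l Q t i v).card ≤ n - Q.card := by
  by_cases h1 : (Q.filter fun x : Fin n => (x : ℕ) / l = (i : ℕ) / l).card < k ∧ 2 * Q.card ≤ n
  swap
  · rw [Finset.filter_false_of_mem]
    · simp
    · exact fun v _ hv => h1 ⟨hv.1, hv.2.1⟩
  obtain ⟨hk, hn⟩ := h1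
  set R := Q.filter fun x : Fin n => (x : ℕ) / l = (i : ℕ) / l with hR
  have hsub : (Finset.univ.filter fun v => Clashes k g l Q t i v) ⊆
      ((Finset.univ.filter fun v : Fin n => (v : ℕ) < g) ∪
        (Finset.univ.filter fun v : Fin n => n < (v : ℕ) + g)) ∪
      R.biUnion fun x : Fin n => Finset.univ.filter fun v : Fin n =>
        (v : ℕ) < (t x : ℕ) + g ∧ (t x : ℕ) < (v : ℕ) + g := by
    intro v hv
    obtain ⟨-, -, h1 | h1 | ⟨x, hx, hxi, h1⟩⟩ := (Finset.mem_filter.mp hv).2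
    · exact Finset.mem_union_left _ (Finset.mem_union_left _ (by simpa using h1))
    · exact Finset.mem_union_left _ (Finset.mem_union_right _ (by simpa using h1))
    · exact Finset.mem_union_right _ (Finset.mem_biUnion.mpr
        ⟨x, Finset.mem_filter.mpr ⟨hx, hxi⟩, by simpa using h1⟩)
  have hlow : (Finset.univ.filter fun v : Fin n => (v : ℕ) < g).card ≤ g := by
    rw [← Finset.card_map Fin.valEmbedding]
    calc _ ≤ (Finset.range g).card := by
          refine Finset.card_le_card fun x hx => ?_
          simp only [Finset.mem_map, Finset.mem_filter, Finset.mem_univ, true_and] at hx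
          obtain ⟨v, hv, rfl⟩ := hx
          exact Finset.mem_range.mpr hv
      _ = g := Finset.card_range g
  have hhigh : (Finset.univ.filter fun v : Fin n => n < (v : ℕ) + g).card ≤ g := by
    rw [← Finset.card_map Fin.valEmbedding]
    calc _ ≤ (Finset.Ico (n - g) n).card := by
          refine Finset.card_le_card fun x hx => ?_
          simp only [Finset.mem_map, Finset.mem_filter, Finset.mem_univ, true_and] at hx
          obtain ⟨v, hv, rfl⟩ := hx
          simp only [Fin.valEmbedding_apply, Finset.mem_Ico]
          omega
      _ ≤ g := by rw [Nat.card_Ico]; omega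
  have hmid := (Finset.card_biUnion_le (s := R) (t := fun x : Fin n => Finset.univ.filter
    fun v : Fin n => (v : ℕ) < (t x : ℕ) + g ∧ (t x : ℕ) < (v : ℕ) + g)).trans
    (Finset.sum_le_card_nsmul _ _ (2 * g) fun x _ => card_near_le g _)
  have hRk : R.card • (2 * g) ≤ k * (2 * g) := Nat.mul_le_mul_right _ hk.le
  have htot : (Finset.univ.filter fun v => Clashes k g l Q t i v).card ≤ g + g + k * (2 * g) :=
    (Finset.card_le_card hsub).trans ((Finset.card_union_le _ _).trans (Nat.add_le_add
      ((Finset.card_union_le _ _).trans (Nat.add_le_add hlow hhigh)) (hmid.trans hRk)))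
  have h2 : k * (g + g + k * (2 * g)) * 2 ≤ n := le_of_eq_of_le (by ring) h
  have := Nat.mul_le_mul_left k htot
  omega

/-- Induction on the decision tree. At a new position the value is uniform among the n - |Q| unused
ones, so a clash has conditional probability at most 1/k and is paid for by this access; a repeated
access creates no clash. -/
theorem sum_card_clashSegments_le {n k g l : ℕ} (h : 4 * k * (k + 1) * g ≤ n) (A : SearchAlg n)
    (Q : Finset (Fin n)) (t₀ : Equiv.Perm (Fin n)) :
    k * ∑ t ∈ agreeing Q t₀, (A.clashSegments k g l t Q).card ≤
      ∑ t ∈ agreeing Q t₀, A.accesses t := by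
  classical
  induction A generalizing Q t₀ with
  | report _ => simp [clashSegments]
  | access i next ih =>
    by_cases hi : i ∈ Q
    · have h1 : ∀ t ∈ agreeing Q t₀, ((access i next).clashSegments k g l t Q).card =
          ((next (t₀ i)).clashSegments k g l t Q).card := by
        intro t ht
        rw [clashSegments, if_neg (fun h => h.1 hi), Finset.insert_eq_of_mem hi,
          mem_agreeing.mp ht i hi]
      have h2 : ∀ t ∈ agreeing Q t₀, (next (t₀ i)).accesses t ≤ (access i next).accesses t := by
        intro t ht
        rw [accesses, mem_agreeing.mp ht i hi]
        exact Nat.le_succ _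
      rw [Finset.sum_congr rfl h1]
      exact (ih _ Q t₀).trans (Finset.sum_le_sum h2)
    · rw [sum_agreeing hi, sum_agreeing hi, Finset.mul_sum]
      set e := (agreeing (insert i Q) t₀).card with he
      have hcard : ∀ t₁, (agreeing (insert i Q) t₁).card = e := fun t₁ => by
        rw [he, card_agreeing, card_agreeing]
      have hval : ∀ v, ∀ t ∈ agreeing (insert i Q) (Equiv.swap (t₀ i) v * t₀), t i = v := by
        intro v t ht
        rw [mem_agreeing.mp ht i (Finset.mem_insert_self _ _)]
        simp
      have hstep : ∀ v ∈ (Q.image t₀)ᶜ,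
          k * ∑ t ∈ agreeing (insert i Q) (Equiv.swap (t₀ i) v * t₀),
            ((access i next).clashSegments k g l t Q).card ≤
          k * (if Clashes k g l Q t₀ i v then e else 0) +
            ∑ t ∈ agreeing (insert i Q) (Equiv.swap (t₀ i) v * t₀), (next v).accesses t := by
        intro v hv
        refine le_trans ?_ (Nat.add_le_add_left (ih v (insert i Q) _) _)
        rw [← mul_add]
        refine Nat.mul_le_mul_left _ ?_
        have hone : ∀ t ∈ agreeing (insert i Q) (Equiv.swap (t₀ i) v * t₀),
            ((access i next).clashSegments k g l t Q).card ≤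
            (if Clashes k g l Q t₀ i v then 1 else 0) +
              ((next v).clashSegments k g l t (insert i Q)).card := by
          intro t ht
          have htQ : ∀ x ∈ Q, t x = t₀ x := fun x hx => by
            rw [mem_agreeing.mp ht x (Finset.mem_insert_of_mem hx)]
            exact swap_mul_apply_of_mem hi (Finset.mem_compl.mp hv) hx
          have hcl : Clashes k g l Q t i v ↔ Clashes k g l Q t₀ i v := by
            unfold Clashes
            refine and_congr_right fun _ => and_congr_right fun _ => or_congr_right
              (or_congr_right (exists_congr fun x => and_congr_right fun hx => ?_))
            rw [htQ x hx]
          rw [clashSegments, hval v t ht]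
          simp only [hi, not_false_eq_true, true_and, hcl]
          split_ifs
          · rw [add_comm]; exact Finset.card_insert_le _ _
          · simp
        refine (Finset.sum_le_sum hone).trans (le_of_eq ?_)
        rw [Finset.sum_add_distrib, Finset.sum_const, hcard]
        split_ifs <;> simp
      refine (Finset.sum_le_sum hstep).trans ?_
      rw [Finset.sum_add_distrib]
      have hR : ∀ v ∈ (Q.image t₀)ᶜ,
          ∑ t ∈ agreeing (insert i Q) (Equiv.swap (t₀ i) v * t₀), (access i next).accesses t =
          e + ∑ t ∈ agreeing (insert i Q) (Equiv.swap (t₀ i) v * t₀), (next v).accesses t := by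
        intro v _
        rw [Finset.sum_congr rfl fun t ht => by rw [accesses, hval v t ht],
          Finset.sum_add_distrib, Finset.sum_const, hcard, smul_eq_mul, mul_one, add_comm]
      rw [Finset.sum_congr rfl hR, Finset.sum_add_distrib]
      refine Nat.add_le_add_right ?_ _
      rw [Finset.sum_const, card_compl_image, smul_eq_mul, ← Finset.mul_sum, ← Finset.sum_filter,
        Finset.sum_const, smul_eq_mul, ← mul_assoc]
      refine Nat.mul_le_mul_right _ (le_trans (Nat.mul_le_mul_left _ (Finset.card_le_card ?_))
        (card_clashes_le (l := l) Q t₀ i h))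
      exact Finset.filter_subset_filter _ (Finset.subset_univ _)

end SearchAlg

/-! ### Completing a partly read text to an occurrence -/

theorem count_add_le_count_add (V : Finset ℕ) {a b : ℕ} (hab : a ≤ b) :
    Nat.count (· ∉ V) a + b ≤ Nat.count (· ∉ V) b + a + V.card := by
  obtain ⟨d, rfl⟩ := Nat.exists_eq_add_of_le hab
  rw [Nat.count_add, Nat.count_eq_card_filter_range (fun j => a + j ∉ V)]
  have h1 := Finset.card_filter_add_card_filter_not (s := Finset.range d) (fun j => a + j ∈ V)
  have h2 : ((Finset.range d).filter fun j => a + j ∈ V).card ≤ V.card := by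
    rw [← Finset.card_map (addLeftEmbedding a)]
    refine Finset.card_le_card fun x hx => ?_
    simp only [Finset.mem_map, Finset.mem_filter, addLeftEmbedding_apply] at hx
    obtain ⟨j, hj, rfl⟩ := hx
    exact hj.2
  rw [Finset.card_range] at h1
  omega

/-- Prescribed values at some arguments extend to an increasing function that avoids the set `V`
at all other arguments, provided the gaps are wide enough. -/
theorem exists_strictMonoOn_extension {m n : ℕ} (V P : Finset ℕ) (u : ℕ → ℕ)
    (hn : m + V.card ≤ n) (hlow : ∀ s ∈ P, s + V.card ≤ u s)
    (hhigh : ∀ s ∈ P, m + V.card + u s ≤ n + s)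
    (hgap : ∀ s ∈ P, ∀ s' ∈ P, s < s' → u s + s' + V.card ≤ u s' + s) :
    ∃ φ : ℕ → ℕ, (∀ s ∈ P, φ s = u s) ∧ (∀ r, r ∉ P → φ r ∉ V) ∧
      StrictMono φ ∧ ∀ r < m, φ r < n := by
  classical
  set N : ℕ → ℕ := fun a => Nat.count (· ∉ V) a with hN
  have hinf : {x | x ∉ V}.Infinite := V.finite_toSet.infinite_compl
  have hNlow : ∀ s ∈ P, s ≤ N (u s) := fun s hs => by
    have h1 := count_add_le_count_add V (Nat.zero_le (u s))
    have h2 := hlow s hs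
    simp only [Nat.count_zero] at h1
    simp only [hN]
    omega
  have hNgap : ∀ s ∈ P, ∀ s' ∈ P, s < s' → N (u s) + s' ≤ N (u s') + s :=
      fun s hs s' hs' hss => by
    have h2 := hgap s hs s' hs' hss
    have h1 := count_add_le_count_add V (show u s ≤ u s' by omega)
    simp only [hN]
    omega
  have hNhigh : ∀ s ∈ P, s < m → N (u s) + m ≤ N n + s := fun s hs hsm => by
    have h2 := hhigh s hs
    have h1 := count_add_le_count_add V (show u s ≤ n by omega)
    simp only [hN]
    omega
  have hNn : m ≤ N n := by
    have h1 := count_add_le_count_add V (Nat.zero_le n)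
    simp only [Nat.count_zero] at h1
    simp only [hN]
    omega
  -- The displacement forced by the prescribed arguments below r. By `hNlow` the truncated
  -- subtraction loses nothing.
  let h : ℕ → ℕ := fun r => (P.filter (· < r)).sup fun s => N (u s) - s
  have hle : ∀ r, ∀ s ∈ P, s < r → N (u s) - s ≤ h r := fun r s hs hsr =>
    Finset.le_sup (f := fun s => N (u s) - s) (Finset.mem_filter.mpr ⟨hs, hsr⟩)
  have hmono : Monotone h := fun r r' hrr => Finset.sup_mono fun s hs => by
    rw [Finset.mem_filter] at hs ⊢
    exact ⟨hs.1, hs.2.trans_le hrr⟩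
  have hub : ∀ r, ∀ s ∈ P, r < s → h r ≤ N (u s) - s := fun r s hs hrs =>
    Finset.sup_le fun s' hs' => by
      rw [Finset.mem_filter] at hs'
      have := hNgap s' hs'.1 s hs (hs'.2.trans hrs)
      omega
  -- A free argument r takes the value of index r + h r outside `V`: large enough to exceed the
  -- prescribed values to its left, and by `hNgap` small enough to stay below those to its right.
  refine ⟨fun r => if r ∈ P then u r else Nat.nth (· ∉ V) (r + h r), ?_, ?_, ?_, ?_⟩
  · intro s hs
    exact if_pos hs
  · intro r hr
    simp only [if_neg hr]
    exact Nat.nth_mem_of_infinite hinf _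
  · intro r r' hrr
    by_cases hr : r ∈ P <;> by_cases hr' : r' ∈ P
    · simp only [if_pos hr, if_pos hr']
      have := hgap r hr r' hr' hrr
      omega
    · simp only [if_pos hr, if_neg hr']
      refine (Nat.le_nth_count hinf (u r)).trans_lt (Nat.nth_strictMono hinf ?_)
      have h2 := hle r' r hr hrr
      have h3 := hNlow r hr
      simp only [hN] at h2 h3
      omega
    · simp only [if_neg hr, if_pos hr']
      refine Nat.nth_lt_of_lt_count ?_
      have h1 := hub r r' hr' hrr
      have h2 := hNlow r' hr'
      simp only [hN] at h1 h2
      omega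
    · simp only [if_neg hr, if_neg hr']
      refine (Nat.nth_strictMono hinf) ?_
      have := hmono hrr.le
      omega
  · intro r hrm
    by_cases hr : r ∈ P
    · simp only [if_pos hr]
      have := hhigh r hr
      omega
    · simp only [if_neg hr]
      refine Nat.nth_lt_of_lt_count ?_
      have h1 : h r ≤ N n - m := Finset.sup_le fun s hs => by
        rw [Finset.mem_filter] at hs
        have := hNhigh s hs.1 (hs.2.trans hrm)
        omega
      simp only [hN] at h1 hNn
      omega

/-- A text can be changed outside `Q` so that the pattern `p` occurs at `b`, if the ranks of the
known symbols in the window are compatible with `p` with enough room for the other symbols. -/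
theorem exists_agreeing_occursAt {m n : ℕ} (p : Equiv.Perm (Fin m)) (t : Equiv.Perm (Fin n))
    (Q : Finset (Fin n)) {b : ℕ} (hb : b + m ≤ n) (hn : m + Q.card ≤ n)
    (hlow : ∀ (y : Fin m) (x : Fin n), x ∈ Q → (x : ℕ) = b + y →
      (p y : ℕ) + Q.card ≤ t x ∧ m + Q.card + t x ≤ n + p y)
    (hgap : ∀ (y y' : Fin m) (x x' : Fin n), x ∈ Q → x' ∈ Q → (x : ℕ) = b + y →
      (x' : ℕ) = b + y' → p y < p y' → (t x : ℕ) + p y' + Q.card ≤ (t x' : ℕ) + p y) :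
    ∃ t' : Equiv.Perm (Fin n), (∀ x ∈ Q, t' x = t x) ∧ OccursAt p t' b := by
  classical
  let pos : Fin m → Fin n := fun y => ⟨b + y, by omega⟩
  have hpos : Function.Injective pos := fun y y' h => by
    have : b + (y : ℕ) = b + y' := congrArg Fin.val h
    exact Fin.ext (by omega)
  let V : Finset ℕ := Q.image fun x => (t x : ℕ)
  have hV : V.card = Q.card := Finset.card_image_of_injective _ fun x y h => t.injective (Fin.ext h)
  let P : Finset ℕ := (Finset.univ.filter fun y : Fin m => pos y ∈ Q).image fun y => (p y : ℕ)
  let u : ℕ → ℕ := fun s => if hs : s < m then (t (pos (p.symm ⟨s, hs⟩)) : ℕ) else 0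
  have hu : ∀ y, u (p y) = t (pos y) := fun y => by simp [u]
  have hP : ∀ s ∈ P, ∃ y, pos y ∈ Q ∧ s = p y := fun s hs => by
    obtain ⟨y, hy, rfl⟩ := Finset.mem_image.mp hs
    exact ⟨y, by simpa using hy, rfl⟩
  have hP' : ∀ y, (p y : ℕ) ∈ P → pos y ∈ Q := fun y hy => by
    obtain ⟨y', hy', h⟩ := hP _ hy
    rwa [p.injective (Fin.ext h)]
  obtain ⟨φ, hφP, hφV, hφmono, hφn⟩ := exists_strictMonoOn_extension (m := m) (n := n) V P u
    (by omega)
    (fun s hs => by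
      obtain ⟨y, hy, rfl⟩ := hP s hs
      rw [hu, hV]
      exact (hlow y _ hy rfl).1)
    (fun s hs => by
      obtain ⟨y, hy, rfl⟩ := hP s hs
      rw [hu, hV]
      exact (hlow y _ hy rfl).2)
    (fun s hs s' hs' hss => by
      obtain ⟨y, hy, rfl⟩ := hP s hs
      obtain ⟨y', hy', rfl⟩ := hP s' hs'
      rw [hu, hu, hV]
      exact hgap y y' _ _ hy hy' rfl rfl hss)
  have hφinj : Function.Injective φ := hφmono.injective
  -- Only `Q` and the window matter; elsewhere f is arbitrary, so the truncation of x - b before the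
  -- window does no harm.
  let f : Fin n → Fin n := fun x => if x ∈ Q then t x else
    if hx : (x : ℕ) - b < m then ⟨φ (p ⟨x - b, hx⟩), hφn _ (p _).isLt⟩ else t x
  have hfQ : ∀ x ∈ Q, f x = t x := fun x hx => if_pos hx
  have hfpos : ∀ y, (f (pos y) : ℕ) = φ (p y) := fun y => by
    by_cases hy : pos y ∈ Q
    · rw [hfQ _ hy, ← hu, hφP]
      exact Finset.mem_image_of_mem _ (Finset.mem_filter.mpr ⟨Finset.mem_univ _, hy⟩)
    · have h1 : (pos y : ℕ) - b = y := by simp [pos]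
      simp only [f, if_neg hy, h1, y.isLt, dif_pos]
  have hcross : ∀ x ∈ Q, ∀ y, pos y ∉ Q → f x ≠ f (pos y) := by
    intro x hx y hy h
    have h1 : (p y : ℕ) ∉ P := fun h => hy (hP' y h)
    refine hφV _ h1 ?_
    rw [← hfpos, ← h, hfQ x hx]
    exact Finset.mem_image_of_mem _ hx
  have hinj : Set.InjOn f (Q ∪ Finset.univ.image pos : Finset (Fin n)) := by
    have hmem : ∀ x ∈ (Q ∪ Finset.univ.image pos : Finset (Fin n)), x ∈ Q ∨
        ∃ y, pos y ∉ Q ∧ x = pos y := by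
      intro x hx
      by_cases hxQ : x ∈ Q
      · exact Or.inl hxQ
      · rcases Finset.mem_union.mp hx with h | h
        · exact Or.inl h
        · obtain ⟨y, -, rfl⟩ := Finset.mem_image.mp h
          exact Or.inr ⟨y, hxQ, rfl⟩
    intro x hx x' hx' h
    rcases hmem x hx with h1 | ⟨y, h1, rfl⟩ <;> rcases hmem x' hx' with h2 | ⟨y', h2, rfl⟩
    · rw [hfQ x h1, hfQ x' h2] at h
      exact t.injective h
    · exact absurd h (hcross x h1 y' h2)
    · exact absurd h.symm (hcross x' h2 y h1)
    · have h3 := congrArg Fin.val h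
      rw [hfpos, hfpos] at h3
      rw [p.injective (Fin.ext (hφinj h3))]
  obtain ⟨g, hg⟩ := Finset.exists_equiv_extend_of_card_eq (t := Finset.univ)
    (by simp) (Finset.subset_univ _) hinj
  let t' : Equiv.Perm (Fin n) := g.trans (Equiv.subtypeUnivEquiv Finset.mem_univ)
  have ht' : ∀ x ∈ (Q ∪ Finset.univ.image pos : Finset (Fin n)), t' x = f x := hg
  have ht'pos : ∀ y, (t' (pos y) : ℕ) = φ (p y) := fun y => by
    rw [ht' _ (Finset.mem_union_right _ (Finset.mem_image_of_mem _ (Finset.mem_univ y))), hfpos]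
  refine ⟨t', fun x hx => (ht' x (Finset.mem_union_left _ hx)).trans (hfQ x hx), hb, ?_⟩
  intro y y'
  change p y < p y' ↔ (t' (pos y) : ℕ) < t' (pos y')
  rw [ht'pos, ht'pos, hφmono.lt_iff_lt, Fin.lt_def]

/-- Exchanging two symbols in an occurrence destroys it. -/
theorem not_occursAt_mul_swap {m n : ℕ} {p : Equiv.Perm (Fin m)} {t : Equiv.Perm (Fin n)} {b : ℕ}
    (h : OccursAt p t b) {y y' : Fin m} (hy : p y < p y') {x x' : Fin n} (hx : (x : ℕ) = b + y)
    (hx' : (x' : ℕ) = b + y') : ¬OccursAt p (t * Equiv.swap x x') b := by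
  obtain ⟨hb, h⟩ := h
  rintro ⟨_, h'⟩
  have ex : x = ⟨b + y, by omega⟩ := Fin.ext hx
  have ex' : x' = ⟨b + y', by omega⟩ := Fin.ext hx'
  have h1 := (h y y').mp hy
  have h2 := (h' y y').mp hy
  rw [← ex, ← ex'] at h1 h2
  simp only [Equiv.Perm.mul_apply, Equiv.swap_apply_left, Equiv.swap_apply_right] at h2
  exact lt_asymm h1 h2

/-- A correct search algorithm must leave no doubt about any window. -/
theorem SearchAlg.Searches.card_le {m n : ℕ} {p : Equiv.Perm (Fin m)} {A : SearchAlg n}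
    (hA : A.Searches p) {t t' : Equiv.Perm (Fin n)} {b : ℕ}
    (ht' : ∀ x ∈ A.readSet t, t' x = t x) (hocc : OccursAt p t' b) :
    m ≤ (Finset.univ.filter fun y : Fin m => ∃ x ∈ A.readSet t, (x : ℕ) = b + y).card + 1 := by
  by_contra! hc
  have hb := hocc.1
  have h1 := Finset.card_filter_add_card_filter_not (s := (Finset.univ : Finset (Fin m)))
    (fun y : Fin m => ∃ x ∈ A.readSet t, (x : ℕ) = b + y)
  rw [Finset.card_univ, Fintype.card_fin] at h1
  obtain ⟨y, hy, y', hy', hne⟩ := Finset.one_lt_card.mp (show 1 < (Finset.univ.filter fun y : Fin m =>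
    ¬∃ x ∈ A.readSet t, (x : ℕ) = b + y).card by omega)
  wlog hlt : p y < p y' generalizing y y'
  · exact this y' hy' y hy hne.symm (lt_of_le_of_ne (not_lt.mp hlt)
      fun h => hne (p.injective h).symm)
  simp only [Finset.mem_filter, Finset.mem_univ, true_and, not_exists, not_and] at hy hy'
  let x : Fin n := ⟨b + y, by omega⟩
  let x' : Fin n := ⟨b + y', by omega⟩
  have hno := not_occursAt_mul_swap hocc hlt (x := x) (x' := x') rfl rfl
  have hag : ∀ z ∈ A.readSet t, (t' * Equiv.swap x x') z = t z := by
    intro z hz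
    rw [Equiv.Perm.mul_apply, Equiv.swap_apply_of_ne_of_ne, ht' z hz]
    · rintro rfl
      exact hy _ hz rfl
    · rintro rfl
      exact hy' _ hz rfl
  rw [← hA, SearchAlg.output_congr A hag, ← SearchAlg.output_congr A ht', hA] at hno
  exact hno hocc

/-- Here c is the value u rescaled by m/n ≤ 2/3. Rescaling moves u away from either border by at
least a third of its distance g, which covers the error ε and the v occupied values. -/
theorem rank_room {m n u c s ε v g : ℕ} (hmn : 3 * m ≤ 2 * n) (hn : 0 < n) (hc1 : n * c ≤ u * m)
    (hc2 : u * m < n * (c + 1)) (h1 : s ≤ c + ε) (h2 : c ≤ s + ε) (hg : 3 * (2 * ε + 1 + v) ≤ g)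
    (hu1 : g ≤ u) (hu2 : u + g ≤ n) : s + v ≤ u ∧ m + v + u ≤ n + s := by
  zify at *
  constructor
  · have h3 : (n : ℤ) * (s + v) ≤ n * u := by
      have e1 := mul_le_mul_of_nonneg_left h1 hn.le
      have e2 := mul_le_mul_of_nonneg_left hmn (show (0 : ℤ) ≤ u by positivity)
      have e3 := mul_le_mul_of_nonneg_left (hg.trans hu1) hn.le
      have e4 : (0 : ℤ) ≤ n * ε := by positivity
      linarith
    exact le_of_mul_le_mul_left h3 hn
  · have h3 : (n : ℤ) * (m + v + u) ≤ n * (n + s) := by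
      have e1 := mul_le_mul_of_nonneg_left h2 hn.le
      have e2 := mul_le_mul_of_nonneg_left hmn (show (0 : ℤ) ≤ n - u by linarith)
      have e3 := mul_le_mul_of_nonneg_left (show (3 * (2 * ε + 1 + v) : ℤ) ≤ n - u by linarith) hn.le
      have e4 : (0 : ℤ) ≤ n * ε := by positivity
      linarith
    exact le_of_mul_le_mul_left h3 hn

/-- If u precedes u', rescaling shrinks their gap by at least g/3, which is the room needed. The
opposite order is impossible: a gap g rescales to at least 2ε + 1, too much for errors ε to turn
around. -/
theorem rank_gap {m n u c s u' c' s' ε v g : ℕ} (hmn : 3 * m ≤ 2 * n) (hn : 0 < n)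
    (hc2 : u * m < n * (c + 1)) (h2 : c ≤ s + ε) (hc1' : n * c' ≤ u' * m) (h1' : s' ≤ c' + ε)
    (hg : 3 * (2 * ε + 1 + v) ≤ g) (hgm : n * (2 * ε + 1) ≤ g * m)
    (hss : s < s') (huu : u + g ≤ u' ∨ u' + g ≤ u) : u + s' + v ≤ u' + s := by
  zify at *
  rcases huu with huu | huu
  · have h3 : (n : ℤ) * (u + s' + v) ≤ n * (u' + s) := by
      have e1 := mul_le_mul_of_nonneg_left h2 hn.le
      have e1' := mul_le_mul_of_nonneg_left h1' hn.le
      have e2 := mul_le_mul_of_nonneg_left hmn (show (0 : ℤ) ≤ u' - u by linarith)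
      have e3 := mul_le_mul_of_nonneg_left (show (3 * (2 * ε + 1 + v) : ℤ) ≤ u' - u by linarith)
        hn.le
      linarith
    exact le_of_mul_le_mul_left h3 hn
  · exfalso
    have e1 := mul_le_mul_of_nonneg_right huu (show (0 : ℤ) ≤ m by positivity)
    have h3 : (n : ℤ) * (c' + 2 * ε) < n * c := by linarith
    have h4 := lt_of_mul_lt_mul_left h3 hn.le
    linarith

/-! ### The lower bound for flexible patterns -/

namespace SearchAlg

theorem mem_clashSegments_or_le_card {m n k ε g v : ℕ} {p : Equiv.Perm (Fin m)}
    (hp : Flexible k ε p) {A : SearchAlg n} (hA : A.Searches p) (hk : 0 < k) (hkm : k < m)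
    (hmn : 2 * m - 1 ≤ n) (hg : 3 * (2 * ε + 1 + v) ≤ g) (hgm : n * (2 * ε + 1) ≤ g * m)
    (hgn : 4 * k * (k + 1) * g ≤ n) (t : Equiv.Perm (Fin n)) (hv : (A.readSet t).card ≤ v)
    {s : ℕ} (hs : s < n / (2 * m - 1)) (hcl : s ∉ A.clashSegments k g (2 * m - 1) t ∅) :
    k ≤ ((A.readSet t).filter fun x : Fin n => (x : ℕ) / (2 * m - 1) = s).card := by
  classical
  by_contra! hc
  set l := 2 * m - 1 with hl
  set Q := A.readSet t with hQ
  have hm : 2 ≤ m := by omega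
  have hn : 0 < n := by omega
  have hmn3 : 3 * m ≤ 2 * n := by omega
  have h8 : 8 * g ≤ n := by
    refine le_trans (Nat.mul_le_mul_right g ?_) hgn
    nlinarith
  have hspread : SpreadOn g l s t Q := by
    have := spreadOn_union_readSet (k := k) (g := g) (l := l) (s := s) t A ∅ hcl
      (by rwa [Finset.empty_union]) (by rw [Finset.empty_union, ← hQ]; omega)
      (fun x hx => absurd hx (Finset.notMem_empty x))
    rwa [Finset.empty_union] at this
  have hseg : s * l + l ≤ n := by
    have := (Nat.le_div_iff_mul_le (by omega : 0 < l)).mp (Nat.succ_le_of_lt hs)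
    rwa [Nat.succ_mul] at this
  -- The text values of the segment, rescaled to the range of p; the value 0 beyond the text is
  -- never used.
  let c : ℕ → ℕ := fun x => if h : s * l + x < n then (t ⟨s * l + x, h⟩ : ℕ) * m / n else 0
  have hcm : ∀ x, c x < m := by
    intro x
    simp only [c]
    split_ifs with h
    · rw [Nat.div_lt_iff_lt_mul hn, mul_comm]
      exact Nat.mul_lt_mul_of_pos_left (Fin.isLt _) (by omega)
    · omega
  obtain ⟨i, him, hi⟩ := hp
    ((Q.filter fun x : Fin n => (x : ℕ) / l = s).image fun x : Fin n => (x : ℕ) - s * l)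
    (Finset.card_image_le.trans_lt hc) c hcm
  have hdiv : ∀ z < l, (s * l + z) / l = s := fun z hz => by
    rw [mul_comm, Nat.mul_add_div (by omega), Nat.div_eq_of_lt hz, add_zero]
  have hxs : ∀ (y : Fin m) (x : Fin n), (x : ℕ) = s * l + i + y → (x : ℕ) / l = s :=
    fun y x hx => by rw [hx, add_assoc, hdiv _ (by omega)]
  have key : ∀ (y : Fin m) (x : Fin n), x ∈ Q → (x : ℕ) = s * l + i + y →
      ∃ d, n * d ≤ t x * m ∧ t x * m < n * (d + 1) ∧ (p y : ℕ) ≤ d + ε ∧ d ≤ p y + ε := by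
    intro y x hx hxy
    have h1 : c (i + y) = (t x : ℕ) * m / n := by
      have h2 : s * l + (i + y) < n := by omega
      have h3 : (⟨s * l + (i + y), h2⟩ : Fin n) = x := Fin.ext (by rw [hxy, add_assoc])
      simp only [c, dif_pos h2, h3]
    have h2 := hi y (Finset.mem_image.mpr
      ⟨x, Finset.mem_filter.mpr ⟨hx, hxs y x hxy⟩, by rw [hxy]; omega⟩)
    rw [h1] at h2
    exact ⟨_, Nat.mul_div_le _ _, Nat.lt_mul_div_succ _ hn, h2⟩
  have hgQ : 3 * (2 * ε + 1 + Q.card) ≤ g := by omega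
  obtain ⟨t', ht', hocc⟩ := exists_agreeing_occursAt p t Q (b := s * l + i) (by omega) (by omega)
    (fun y x hx hxy => by
      obtain ⟨d, hd1, hd2, hd3, hd4⟩ := key y x hx hxy
      obtain ⟨h1, h2⟩ := (hspread x hx (hxs y x hxy)).1
      exact rank_room hmn3 hn hd1 hd2 hd3 hd4 hgQ h1 h2)
    (fun y y' x x' hx hx' hxy hxy' hyy => by
      obtain ⟨d, -, hd2, -, hd4⟩ := key y x hx hxy
      obtain ⟨d', hd1', -, hd3', -⟩ := key y' x' hx' hxy'
      have hne : x ≠ x' := by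
        rintro rfl
        have : y = y' := Fin.ext (by omega)
        exact lt_irrefl _ (this ▸ hyy)
      exact rank_gap hmn3 hn hd2 hd4 hd1' hd3' hgQ hgm hyy
        ((hspread x hx (hxs y x hxy)).2 x' hx' (hxs y' x' hxy') hne))
  have h1 := hA.card_le ht' hocc
  rw [← hQ] at h1
  -- The whole window lies in the segment, so fewer than k < m of its symbols were read, whereas
  -- correctness requires at least m-1.
  have h2 : (Finset.univ.filter fun y : Fin m => ∃ x ∈ Q, (x : ℕ) = s * l + i + y).card ≤
      (Q.filter fun x : Fin n => (x : ℕ) / l = s).card := by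
    refine Finset.card_le_card_of_injOn (fun y => ⟨s * l + i + y, by omega⟩) ?_ ?_
    · intro y hy
      obtain ⟨x, hx, hxy⟩ := (Finset.mem_filter.mp hy).2
      have : (⟨s * l + i + y, by omega⟩ : Fin n) = x := Fin.ext hxy.symm
      simp only [this]
      exact Finset.mem_filter.mpr ⟨hx, hxs y x hxy⟩
    · intro y _ y' _ h
      have : s * l + i + (y : ℕ) = s * l + i + y' := congrArg Fin.val h
      exact Fin.ext (by omega)
  omega

theorem mul_le_three_mul_sum_accesses {m n k ε g v : ℕ} {p : Equiv.Perm (Fin m)}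
    (hp : Flexible k ε p) {A : SearchAlg n} (hA : A.Searches p) (hk : 0 < k) (hkm : k < m)
    (hmn : 2 * m - 1 ≤ n) (hg : 3 * (2 * ε + 1 + v) ≤ g) (hgm : n * (2 * ε + 1) ≤ g * m)
    (hgn : 4 * k * (k + 1) * g ≤ n) (hv : k * (n / (2 * m - 1)) ≤ v + 1) :
    k * (n / (2 * m - 1)) * n.factorial ≤ 3 * ∑ t : Equiv.Perm (Fin n), A.accesses t := by
  classical
  set l := 2 * m - 1 with hl
  have key : ∀ t : Equiv.Perm (Fin n),
      k * (n / l) ≤ k * (A.clashSegments k g l t ∅).card + 2 * A.accesses t := by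
    intro t
    have hacc := A.card_readSet_le t
    by_cases hr : (A.readSet t).card ≤ v
    -- More than v reads already suffice, by `hv`.
    swap
    · omega
    set F := (Finset.range (n / l)).filter fun s =>
      k ≤ ((A.readSet t).filter fun x : Fin n => (x : ℕ) / l = s).card with hF
    have hsub : Finset.range (n / l) ⊆ A.clashSegments k g l t ∅ ∪ F := by
      intro s hs
      by_cases hcl : s ∈ A.clashSegments k g l t ∅
      · exact Finset.mem_union_left _ hcl
      · exact Finset.mem_union_right _ (Finset.mem_filter.mpr ⟨hs,
          mem_clashSegments_or_le_card hp hA hk hkm hmn hg hgm hgn t hr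
            (Finset.mem_range.mp hs) hcl⟩)
    have h1 := (Finset.card_le_card hsub).trans (Finset.card_union_le _ _)
    rw [Finset.card_range] at h1
    have h2 : F.card * k ≤ (A.readSet t).card := by
      calc F.card * k ≤
          ∑ s ∈ F, ((A.readSet t).filter fun x : Fin n => (x : ℕ) / l = s).card :=
            Finset.card_nsmul_le_sum _ _ _ fun s hs => (Finset.mem_filter.mp hs).2
        _ ≤ ∑ s ∈ F ∪ (A.readSet t).image (fun x : Fin n => (x : ℕ) / l),
            ((A.readSet t).filter fun x : Fin n => (x : ℕ) / l = s).card :=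
            Finset.sum_le_sum_of_subset Finset.subset_union_left
        _ = (A.readSet t).card := (Finset.card_eq_sum_card_fiberwise fun x hx =>
            Finset.mem_union_right _ (Finset.mem_image_of_mem _ hx)).symm
    have h3 := Nat.mul_le_mul_left k h1
    rw [mul_add, mul_comm k F.card] at h3
    omega
  have h1 := Finset.sum_le_sum fun t (_ : t ∈ Finset.univ) => key t
  rw [Finset.sum_const, Finset.card_univ, Fintype.card_perm, Fintype.card_fin, smul_eq_mul,
    Finset.sum_add_distrib, ← Finset.mul_sum, ← Finset.mul_sum] at h1
  have h2 := sum_card_clashSegments_le (l := l) hgn A ∅ 1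
  rw [agreeing_empty] at h2
  rw [mul_comm]
  omega

-- At least half of the patterns are flexible and cost a third of k times the number of segments;
-- the others are counted as nothing.
open Classical in
theorem le_sum_averageAccesses {m n k ε g v : ℕ} (A : Equiv.Perm (Fin m) → SearchAlg n)
    (hA : ∀ p, (A p).Searches p) (hk : 0 < k) (hkm : k < m)
    (hmn : 2 * m - 1 ≤ n) (hg : 3 * (2 * ε + 1 + v) ≤ g) (hgm : n * (2 * ε + 1) ≤ g * m)
    (hgn : 4 * k * (k + 1) * g ≤ n) (hv : k * (n / (2 * m - 1)) ≤ v + 1)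
    (hflex : ((Finset.univ.filter fun p : Equiv.Perm (Fin m) => ¬Flexible k ε p).card : ℝ) ≤
      m.factorial / 2) :
    ((k * (n / (2 * m - 1)) : ℕ) : ℝ) / 6 ≤
      (∑ p : Equiv.Perm (Fin m), (A p).averageAccesses) / (m.factorial : ℝ) := by
  have hm0 : (0 : ℝ) < m.factorial := by exact_mod_cast m.factorial_pos
  have hn0 : (0 : ℝ) < n.factorial := by exact_mod_cast n.factorial_pos
  set a := k * (n / (2 * m - 1)) with ha
  have h1 : ∀ p ∈ Finset.univ.filter fun p : Equiv.Perm (Fin m) => Flexible k ε p,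
      (a : ℝ) / 3 ≤ (A p).averageAccesses := by
    intro p hp
    have h2 := mul_le_three_mul_sum_accesses (Finset.mem_filter.mp hp).2 (hA p) hk hkm hmn hg hgm
      hgn hv
    rw [averageAccesses, le_div_iff₀ hn0]
    have h3 : (a : ℝ) * n.factorial ≤ 3 * ∑ t : Equiv.Perm (Fin n), ((A p).accesses t : ℝ) := by
      exact_mod_cast h2
    linarith
  have h2 : (m.factorial : ℝ) / 2 ≤
      (Finset.univ.filter fun p : Equiv.Perm (Fin m) => Flexible k ε p).card := by
    have h3 := Finset.card_filter_add_card_filter_not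
      (s := (Finset.univ : Finset (Equiv.Perm (Fin m)))) (fun p => Flexible k ε p)
    rw [Finset.card_univ, Fintype.card_perm, Fintype.card_fin] at h3
    have h4 : ((Finset.univ.filter fun p : Equiv.Perm (Fin m) => Flexible k ε p).card : ℝ) +
        (Finset.univ.filter fun p : Equiv.Perm (Fin m) => ¬Flexible k ε p).card =
        m.factorial := by exact_mod_cast h3
    linarith
  rw [le_div_iff₀ hm0]
  calc (a : ℝ) / 6 * m.factorial = m.factorial / 2 * (a / 3) := by ring
    _ ≤ (Finset.univ.filter fun p : Equiv.Perm (Fin m) => Flexible k ε p).card * (a / 3) :=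
        mul_le_mul_of_nonneg_right h2 (by positivity)
    _ ≤ ∑ p ∈ Finset.univ.filter fun p : Equiv.Perm (Fin m) => Flexible k ε p,
        (A p).averageAccesses := by
        rw [← nsmul_eq_mul]
        exact Finset.card_nsmul_le_sum _ _ _ h1
    _ ≤ _ := Finset.sum_le_sum_of_subset_of_nonneg (Finset.subset_univ _) fun p _ _ => by
        unfold averageAccesses
        positivity

end SearchAlg

/-! ### Probing k symbols common to many windows -/

/-- The order of the σ (π j) determines the rank of each σ (π j) in the range of σ, hence π j. -/
theorem eq_of_comp_lt_iff {k : ℕ} {α : Type*} [LinearOrder α] {σ : Fin k → α}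
    (hσ : Function.Injective σ) {π₁ π₂ : Equiv.Perm (Fin k)}
    (h : ∀ j j', σ (π₁ j) < σ (π₁ j') ↔ σ (π₂ j) < σ (π₂ j')) : π₁ = π₂ := by
  have hrank : ∀ (π : Equiv.Perm (Fin k)) j, (Finset.univ.filter fun i => σ (π i) < σ (π j)).card =
      (Finset.univ.filter fun i => σ i < σ (π j)).card := by
    intro π j
    refine Finset.card_equiv π fun i => ?_
    simp
  have hstrict : ∀ a b, σ a < σ b → (Finset.univ.filter fun i => σ i < σ a).card <
      (Finset.univ.filter fun i => σ i < σ b).card := by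
    intro a b hab
    refine Finset.card_lt_card (Finset.ssubset_iff_of_subset ?_ |>.mpr ⟨a, ?_, ?_⟩)
    · intro i hi
      rw [Finset.mem_filter] at hi ⊢
      exact ⟨hi.1, hi.2.trans hab⟩
    · simpa using hab
    · simp
  ext j
  congr 1
  have heq : (Finset.univ.filter fun i => σ i < σ (π₁ j)).card =
      (Finset.univ.filter fun i => σ i < σ (π₂ j)).card := by
    rw [← hrank, ← hrank, Finset.filter_congr fun i _ => h i j]
  rcases lt_trichotomy (σ (π₁ j)) (σ (π₂ j)) with hlt | he | hlt
  · exact absurd heq (hstrict _ _ hlt).ne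
  · exact hσ he
  · exact absurd heq (hstrict _ _ hlt).ne'

/-- Rearranging the k chosen symbols in all k! ways, starting from the texts with the given order,
never produces the same text twice. -/
theorem card_order_iso_mul_factorial_le {n k : ℕ} {α : Type*} [LinearOrder α] {σ : Fin k → α}
    (hσ : Function.Injective σ) (pos : Fin k ↪ Fin n) :
    (Finset.univ.filter fun t : Equiv.Perm (Fin n) =>
      ∀ j j', σ j < σ j' ↔ t (pos j) < t (pos j')).card * k.factorial ≤ n.factorial := by
  classical
  set A := Finset.univ.filter fun t : Equiv.Perm (Fin n) =>
      ∀ j j', σ j < σ j' ↔ t (pos j) < t (pos j') with hA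
  have hk : k.factorial = (Finset.univ : Finset (Equiv.Perm (Fin k))).card := by
    rw [Finset.card_univ, Fintype.card_perm, Fintype.card_fin]
  have hn : n.factorial = (Finset.univ : Finset (Equiv.Perm (Fin n))).card := by
    rw [Finset.card_univ, Fintype.card_perm, Fintype.card_fin]
  rw [hk, hn, ← Finset.card_product]
  refine Finset.card_le_card_of_injOn (fun a => a.1 * a.2.viaEmbedding pos)
    (fun _ _ => Finset.mem_univ _) ?_
  rintro ⟨t₁, π₁⟩ h₁ ⟨t₂, π₂⟩ h₂ h
  have h₁' := (Finset.mem_filter.mp (Finset.mem_product.mp h₁).1).2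
  have h₂' := (Finset.mem_filter.mp (Finset.mem_product.mp h₂).1).2
  simp only at h h₁' h₂'
  have hval : ∀ j, t₁ (pos (π₁ j)) = t₂ (pos (π₂ j)) := fun j => by
    have := DFunLike.congr_fun h (pos j)
    simpa only [Equiv.Perm.mul_apply, Equiv.Perm.viaEmbedding_apply] using this
  have hπ : π₁ = π₂ := eq_of_comp_lt_iff hσ fun j j' => by
    rw [h₁', h₂', hval, hval]
  subst hπ
  rw [mul_right_cancel h]

/-- The function `f` shows the pattern `p` at the position `i`. -/
def OccursIn {m n : ℕ} (p : Equiv.Perm (Fin m)) (f : Fin n → Fin n) (i : ℕ) : Prop :=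
  ∃ h : i + m ≤ n, ∀ k l : Fin m,
    p k < p l ↔ f ⟨i + k, by omega⟩ < f ⟨i + l, by omega⟩

/-- The positions `x` with `a ≤ x < b`. -/
def positions (n a b : ℕ) : Finset (Fin n) :=
  Finset.univ.filter fun x => a ≤ (x : ℕ) ∧ (x : ℕ) < b

theorem mem_positions {n a b : ℕ} {x : Fin n} :
    x ∈ positions n a b ↔ a ≤ (x : ℕ) ∧ (x : ℕ) < b := by
  simp [positions]

theorem card_positions_le (n a b : ℕ) : (positions n a b).card ≤ b - a := by
  rw [← Finset.card_map Fin.valEmbedding, ← Nat.card_Ico]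
  refine Finset.card_le_card fun x hx => ?_
  obtain ⟨y, hy, rfl⟩ := Finset.mem_map.mp hx
  exact Finset.mem_Ico.mpr (mem_positions.mp hy)

theorem occursIn_congr {m n : ℕ} {p : Equiv.Perm (Fin m)} {f f' : Fin n → Fin n} {i : ℕ}
    (h : ∀ x ∈ positions n i (i + m), f x = f' x) : OccursIn p f i ↔ OccursIn p f' i := by
  refine exists_congr fun hi => forall₂_congr fun k l => ?_
  rw [h _ (mem_positions.mpr ⟨by simp, by simp⟩), h _ (mem_positions.mpr ⟨by simp, by simp⟩)]

/-- The `k` symbols of `f` from the position `a + h` on are compatible with an occurrence of `p` at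
one of the positions `a, …, a + h - 1`. -/
def ProbeMatches {m n : ℕ} (p : Equiv.Perm (Fin m)) (h k : ℕ) (f : Fin n → Fin n) (a : ℕ) : Prop :=
  ∃ d < h, ∀ x ∈ positions n (a + h) (a + h + k), ∀ x' ∈ positions n (a + h) (a + h + k),
    ∀ y y' : Fin m, a + d + y = x → a + d + y' = x' → (p y < p y' ↔ f x < f x')

theorem probeMatches_congr {m n : ℕ} {p : Equiv.Perm (Fin m)} {h k a : ℕ} {f f' : Fin n → Fin n}
    (hf : ∀ x ∈ positions n (a + h) (a + h + k), f x = f' x) :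
    ProbeMatches p h k f a ↔ ProbeMatches p h k f' a := by
  refine exists_congr fun d => and_congr_right fun _ => forall₂_congr fun x hx =>
    forall₂_congr fun x' hx' => ?_
  rw [hf x hx, hf x' hx']

theorem OccursAt.probeMatches {m n : ℕ} {p : Equiv.Perm (Fin m)} {t : Equiv.Perm (Fin n)}
    {h k a i : ℕ} (ht : OccursAt p t i) (hi : a ≤ i) (hi' : i < a + h) :
    ProbeMatches p h k t a := by
  obtain ⟨hb, ht⟩ := ht
  refine ⟨i - a, by omega, fun x _ x' _ y y' hy hy' => ?_⟩
  rw [ht y y']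
  have e : (⟨i + y, by omega⟩ : Fin n) = x := Fin.ext (by simp only; omega)
  have e' : (⟨i + y', by omega⟩ : Fin n) = x' := Fin.ext (by simp only; omega)
  rw [e, e']

-- Union bound over the h offsets. As h + k ≤ m, every window of the block contains all probed
-- positions, so each offset prescribes their complete relative order.
open Classical in
theorem card_probeMatches_mul_factorial_le {m n h k a : ℕ} (p : Equiv.Perm (Fin m))
    (hn : a + h + k ≤ n) (hm : h + k ≤ m) :
    (Finset.univ.filter fun t : Equiv.Perm (Fin n) => ProbeMatches p h k t a).card * k.factorial ≤
      h * n.factorial := by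
  let pos : Fin k ↪ Fin n := ⟨fun j => ⟨a + h + j, by omega⟩, fun j j' hj => by
    have : a + h + (j : ℕ) = a + h + j' := congrArg Fin.val hj
    exact Fin.ext (by omega)⟩
  let σ : ℕ → Fin k → Fin m := fun d j => p ⟨h - d + j, by omega⟩
  have hσ : ∀ d, Function.Injective (σ d) := fun d j j' hj => by
    have : h - d + (j : ℕ) = h - d + j' := congrArg Fin.val (p.injective hj)
    exact Fin.ext (by omega)
  have hsub : (Finset.univ.filter fun t : Equiv.Perm (Fin n) => ProbeMatches p h k t a) ⊆
      (Finset.range h).biUnion fun d => Finset.univ.filter fun t : Equiv.Perm (Fin n) =>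
        ∀ j j', σ d j < σ d j' ↔ t (pos j) < t (pos j') := by
    intro t ht
    obtain ⟨d, hd, ht⟩ := (Finset.mem_filter.mp ht).2
    refine Finset.mem_biUnion.mpr ⟨d, Finset.mem_range.mpr hd,
      Finset.mem_filter.mpr ⟨Finset.mem_univ _, fun j j' => ?_⟩⟩
    have hpos : ∀ j, pos j ∈ positions n (a + h) (a + h + k) := fun j =>
      mem_positions.mpr ⟨Nat.le_add_right _ _, Nat.add_lt_add_left j.isLt _⟩
    exact ht _ (hpos j) _ (hpos j') _ _ (show a + d + (h - d + (j : ℕ)) = a + h + j by omega)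
      (show a + d + (h - d + (j' : ℕ)) = a + h + j' by omega)
  calc _ ≤ (∑ d ∈ Finset.range h, (Finset.univ.filter fun t : Equiv.Perm (Fin n) =>
        ∀ j j', σ d j < σ d j' ↔ t (pos j) < t (pos j')).card) * k.factorial :=
        Nat.mul_le_mul_right _ ((Finset.card_le_card hsub).trans Finset.card_biUnion_le)
    _ ≤ ∑ d ∈ Finset.range h, n.factorial := by
        rw [Finset.sum_mul]
        exact Finset.sum_le_sum fun d _ => card_order_iso_mul_factorial_le (hσ d) pos
    _ = _ := by rw [Finset.sum_const, Finset.card_range, smul_eq_mul]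

/-! ### The block algorithm and its cost -/

namespace SearchAlg

/-- Access the positions in a list one after the other, record the symbols found there in `f`, and
continue with the resulting function. -/
def readAll {n : ℕ} : List (Fin n) → (Fin n → Fin n) → ((Fin n → Fin n) → SearchAlg n) → SearchAlg n
  | [], f, next => next f
  | i :: l, f, next => access i fun v => readAll l (Function.update f i v) next

/-- The function `f` with the symbols of `t` at the positions in `l` recorded. -/
def record {n : ℕ} (t : Equiv.Perm (Fin n)) (l : List (Fin n)) (f : Fin n → Fin n) : Fin n → Fin n :=
  fun x => if x ∈ l then t x else f x

theorem record_nil {n : ℕ} (t : Equiv.Perm (Fin n)) (f : Fin n → Fin n) : record t [] f = f := by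
  funext x
  simp [record]

theorem record_cons {n : ℕ} (t : Equiv.Perm (Fin n)) (i : Fin n) (l : List (Fin n))
    (f : Fin n → Fin n) : record t l (Function.update f i (t i)) = record t (i :: l) f := by
  funext x
  by_cases hx : x ∈ l
  · simp [record, hx]
  · by_cases hxi : x = i
    · subst hxi
      simp [record]
    · simp [record, hx, hxi]

theorem output_readAll {n : ℕ} (t : Equiv.Perm (Fin n)) (l : List (Fin n)) (f : Fin n → Fin n)
    (next : (Fin n → Fin n) → SearchAlg n) :
    (readAll l f next).output t = (next (record t l f)).output t := by
  induction l generalizing f with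
  | nil => simp [readAll, record_nil]
  | cons i l ih => rw [readAll, output, ih, record_cons]

theorem accesses_readAll {n : ℕ} (t : Equiv.Perm (Fin n)) (l : List (Fin n)) (f : Fin n → Fin n)
    (next : (Fin n → Fin n) → SearchAlg n) :
    (readAll l f next).accesses t = (next (record t l f)).accesses t + l.length := by
  induction l generalizing f with
  | nil => simp [readAll, record_nil]
  | cons i l ih => rw [readAll, accesses, ih, record_cons, List.length_cons, add_assoc]

open Classical in
/-- Search for `p` in `b` blocks of `h` candidate positions each: of every block `k` symbols common
to all candidate windows are read, and the rest only if these do not exclude an occurrence. -/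
noncomputable def probeBlocks {m : ℕ} (n : ℕ) (p : Equiv.Perm (Fin m)) (h k : ℕ) :
    ℕ → Finset ℕ → SearchAlg n
  | 0, s => report s
  -- The initial function `id` is arbitrary: both tests consult recorded positions only.
  | b + 1, s => readAll (positions n (b * h + h) (b * h + h + k)).toList id fun f =>
      if ProbeMatches p h k f (b * h) then
        readAll (positions n (b * h) (b * h + h + m)).toList f fun f' =>
          probeBlocks n p h k b (s ∪ (Finset.Ico (b * h) (b * h + h)).filter (OccursIn p f'))
      else probeBlocks n p h k b s

theorem probeMatches_record {m n : ℕ} (p : Equiv.Perm (Fin m)) (h k a : ℕ) (t : Equiv.Perm (Fin n))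
    (f : Fin n → Fin n) :
    ProbeMatches p h k (record t (positions n (a + h) (a + h + k)).toList f) a ↔
      ProbeMatches p h k t a :=
  probeMatches_congr fun x hx => by simp [record, hx]

theorem mem_output_probeBlocks {m n : ℕ} (p : Equiv.Perm (Fin m)) (h k : ℕ) (t : Equiv.Perm (Fin n))
    (b : ℕ) (s : Finset ℕ) (i : ℕ) :
    i ∈ (probeBlocks n p h k b s).output t ↔ i ∈ s ∨ i < b * h ∧ OccursAt p t i := by
  classical
  induction b generalizing s with
  | zero => simp [probeBlocks, output]
  | succ b ih =>
    rw [probeBlocks, output_readAll, probeMatches_record, Nat.succ_mul]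
    split_ifs with hm
    · rw [output_readAll, ih, Finset.mem_union, Finset.mem_filter, Finset.mem_Ico, or_assoc]
      refine or_congr_right ?_
      have hocc : ∀ f j, b * h ≤ j → j < b * h + h →
          (OccursIn p (record t (positions n (b * h) (b * h + h + m)).toList f) j ↔
            OccursAt p t j) := fun f j h1 h2 =>
        occursIn_congr fun x hx => by
          rw [mem_positions] at hx
          have : x ∈ positions n (b * h) (b * h + h + m) := mem_positions.mpr (by omega)
          simp [record, this]
      constructor
      · rintro (⟨⟨h1, h2⟩, h3⟩ | ⟨h1, h3⟩)
        · exact ⟨h2, (hocc _ i h1 h2).mp h3⟩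
        · exact ⟨by omega, h3⟩
      · rintro ⟨h1, h3⟩
        rcases lt_or_ge i (b * h) with h2 | h2
        · exact Or.inr ⟨h2, h3⟩
        · exact Or.inl ⟨⟨h2, h1⟩, (hocc _ i h2 h1).mpr h3⟩
    · rw [ih]
      refine or_congr_right (and_congr_left fun hocc => ⟨fun h1 => by omega, fun h1 => ?_⟩)
      by_contra! h2
      exact hm (hocc.probeMatches h2 h1)

open Classical in
theorem accesses_probeBlocks_le {m n : ℕ} (p : Equiv.Perm (Fin m)) (h k : ℕ) (t : Equiv.Perm (Fin n))
    (b : ℕ) (s : Finset ℕ) :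
    (probeBlocks n p h k b s).accesses t ≤
      ∑ j ∈ Finset.range b, (k + if ProbeMatches p h k t (j * h) then h + m else 0) := by
  induction b generalizing s with
  | zero => simp [probeBlocks, accesses]
  | succ b ih =>
    rw [probeBlocks, accesses_readAll, probeMatches_record, Finset.sum_range_succ,
      Finset.length_toList]
    have h1 := card_positions_le n (b * h + h) (b * h + h + k)
    have h2 := card_positions_le n (b * h) (b * h + h + m)
    split_ifs with hm
    · rw [accesses_readAll, Finset.length_toList]
      have := ih (s ∪ (Finset.Ico (b * h) (b * h + h)).filter (OccursIn p
        (record t (positions n (b * h) (b * h + h + m)).toList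
          (record t (positions n (b * h + h) (b * h + h + k)).toList id))))
      omega
    · have := ih s
      omega

theorem exists_searches_averageAccesses_le {m n h k : ℕ} (p : Equiv.Perm (Fin m)) (hh : 0 < h)
    (hm : h + k ≤ m) (hn : m ≤ n) (hk : (h + m) * h ≤ k.factorial) :
    ∃ A : SearchAlg n, A.Searches p ∧
      A.averageAccesses ≤ (((n - m) / h + 1) * (k + 1) : ℕ) := by
  classical
  -- Enough blocks to cover the candidates 0, …, n - m; in the last block, candidates beyond n - m
  -- are rejected by `OccursIn`.
  set B := (n - m) / h + 1 with hB
  refine ⟨probeBlocks n p h k B ∅, fun t i => ?_, ?_⟩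
  · rw [mem_output_probeBlocks]
    simp only [Finset.notMem_empty, false_or, and_iff_right_iff_imp]
    rintro ⟨hi, -⟩
    have := Nat.lt_mul_div_succ (n - m) hh
    rw [hB, mul_comm]
    omega
  · have hn0 : (0 : ℝ) < n.factorial := by exact_mod_cast n.factorial_pos
    rw [averageAccesses, div_le_iff₀ hn0]
    norm_cast
    calc ∑ t : Equiv.Perm (Fin n), (probeBlocks n p h k B ∅).accesses t
        ≤ ∑ t : Equiv.Perm (Fin n), ∑ j ∈ Finset.range B,
            (k + if ProbeMatches p h k t (j * h) then h + m else 0) :=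
          Finset.sum_le_sum fun t _ => accesses_probeBlocks_le p h k t B ∅
      _ = ∑ j ∈ Finset.range B, ∑ t : Equiv.Perm (Fin n),
            (k + if ProbeMatches p h k t (j * h) then h + m else 0) := Finset.sum_comm
      _ ≤ ∑ j ∈ Finset.range B, (k + 1) * n.factorial := by
          refine Finset.sum_le_sum fun j hj => ?_
          have hj' : j * h ≤ n - m := by
            have h1 : j ≤ (n - m) / h := Nat.lt_succ_iff.mp (Finset.mem_range.mp hj)
            exact (Nat.le_div_iff_mul_le hh).mp h1
          have h1 := card_probeMatches_mul_factorial_le (n := n) (a := j * h) p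
            (by omega) hm
          rw [Finset.sum_add_distrib, Finset.sum_const, Finset.card_univ, Fintype.card_perm,
            Fintype.card_fin, smul_eq_mul, ← Finset.sum_filter, Finset.sum_const, smul_eq_mul,
            add_mul, one_mul, mul_comm k]
          -- A full check costs at most h + m and has probability at most h/k!, hence at most 1 on
          -- average by `hk`.
          refine Nat.add_le_add_left ?_ _
          refine le_of_mul_le_mul_right ?_ k.factorial_pos
          calc _ = (Finset.univ.filter fun t : Equiv.Perm (Fin n) =>
                  ProbeMatches p h k t (j * h)).card * k.factorial * (h + m) := by ring
            _ ≤ h * n.factorial * (h + m) := Nat.mul_le_mul_right _ h1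
            _ = n.factorial * ((h + m) * h) := by ring
            _ ≤ _ := Nat.mul_le_mul_left _ hk
      _ = _ := by rw [Finset.sum_const, Finset.card_range, smul_eq_mul, mul_assoc]

end SearchAlg

/-! ### Choice of the parameters, with x = log m -/

open Filter in
theorem eventually_atTop_growth : ∀ᶠ x : ℝ in atTop, 2 ≤ Real.log x ∧ 16 * Real.log x ≤ x ∧
    2 ^ 20 * x ^ 6 ≤ Real.exp x ∧ 6 * x ^ 2 + 2 ≤ Real.exp (x / 4) := by
  have h1 := Real.tendsto_log_atTop.eventually_ge_atTop 2
  have h2 := Real.isLittleO_log_id_atTop.bound (show (0 : ℝ) < 1 / 16 by norm_num)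
  have h3 := (isLittleO_pow_exp_pos_mul_atTop (k := 6) (b := 1) one_pos).bound
    (show (0 : ℝ) < 1 / 2 ^ 20 by norm_num)
  have h4 := (isLittleO_pow_exp_pos_mul_atTop (k := 2) (b := 1 / 4) (by norm_num)).bound
    (show (0 : ℝ) < 1 / 8 by norm_num)
  filter_upwards [h1, h2, h3, h4, eventually_ge_atTop 1] with x h1 h2 h3 h4 h5
  rw [Real.norm_of_nonneg (by linarith), id, Real.norm_of_nonneg (by linarith)] at h2
  rw [Real.norm_of_nonneg (by positivity), Real.norm_of_nonneg (by positivity), one_mul] at h3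
  rw [Real.norm_of_nonneg (by positivity), Real.norm_of_nonneg (by positivity),
    show 1 / 4 * x = x / 4 by ring] at h4
  refine ⟨h1, by linarith, by linarith, by nlinarith⟩

theorem exists_segment_parameters {k m n : ℕ} (hk : 0 < k) (hm : 1024 * k ^ 3 ≤ m)
    (hn : 2 * m - 1 ≤ n) :
    ∃ g v : ℕ, 3 * (2 * (m / (64 * k ^ 2)) + 1 + v) ≤ g ∧
      n * (2 * (m / (64 * k ^ 2)) + 1) ≤ g * m ∧ 4 * k * (k + 1) * g ≤ n ∧
      k * (n / (2 * m - 1)) ≤ v + 1 := by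
  have hk2 : 1 ≤ k ^ 2 := Nat.one_le_pow _ _ hk
  have hk23 : k ^ 2 ≤ k ^ 3 := Nat.pow_le_pow_right hk (by norm_num)
  have hK : 0 < 64 * k ^ 2 := by positivity
  have he := Nat.mul_div_le m (64 * k ^ 2)
  have hv := Nat.mul_div_le n (128 * k ^ 2)
  have hg := Nat.mul_div_le n (8 * k ^ 2)
  have hg' := Nat.lt_mul_div_succ n (show 0 < 8 * k ^ 2 by positivity)
  set e := m / (64 * k ^ 2)
  set v := n / (128 * k ^ 2) with hvdef
  set g := n / (8 * k ^ 2)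
  have hmn : 3 * m ≤ 2 * n := by omega
  -- g = n/(8k²) makes clashes rare enough, since 4k(k+1) ≤ 8k²; ε and v are small enough multiples
  -- of m/k² and n/k² to fit into g/3.
  refine ⟨g, v, ?_, ?_, ?_, ?_⟩
  · have h1 : 128 * k ^ 2 * (3 * (2 * e + 1 + v)) < 128 * k ^ 2 * (g + 1) := by nlinarith
    exact Nat.lt_succ_iff.mp (lt_of_mul_lt_mul_left h1 (Nat.zero_le _))
  · refine le_of_mul_le_mul_left (a := 64 * k ^ 2) ?_ hK
    have h1 : n * (64 * k ^ 2 * e) ≤ n * m := Nat.mul_le_mul_left _ he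
    have h2 : m * n ≤ m * (8 * k ^ 2 * (g + 1)) := Nat.mul_le_mul_left _ hg'.le
    have h3 : n * (1024 * k ^ 2) ≤ n * m := Nat.mul_le_mul_left _ (by omega)
    have h4 : 1024 * k ^ 2 * m ≤ n * m := Nat.mul_le_mul_right _ (by omega)
    nlinarith
  · refine le_trans (Nat.mul_le_mul_right g ?_) hg
    nlinarith
  · refine Nat.le_succ_of_le ((Nat.le_div_iff_mul_le (by positivity)).mpr ?_)
    have h1 := Nat.div_mul_le_self n (2 * m - 1)
    refine le_trans ?_ h1
    calc k * (n / (2 * m - 1)) * (128 * k ^ 2) = n / (2 * m - 1) * (128 * k ^ 3) := by ring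
      _ ≤ _ := Nat.mul_le_mul_left _ (by omega)

/-- One trial succeeds with probability at least (1/(128k²))^k ≥ x^(-2k) ≥ exp(-x/4). Thus √m =
exp(x/2) trials, up to rounding, all fail with probability at most exp(-exp(x/4)/2), against at most
exp(3x²) prescriptions. -/
theorem pow_mul_one_sub_pow_le_half {x : ℝ} {m k τ : ℕ} (hmx : (m : ℝ) = Real.exp x)
    (hlog : 2 ≤ Real.log x) (hexp : 6 * x ^ 2 + 2 ≤ Real.exp (x / 4))
    (hk0 : 0 < k) (hk : (k : ℝ) * (8 * Real.log x) ≤ x) (hτm : τ ≤ m)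
    (hτ : m ≤ 128 * k ^ 2 * τ) :
    (2 * m * m : ℝ) ^ k * (1 - ((τ : ℝ) / m) ^ k) ^ Nat.sqrt m ≤ 1 / 2 := by
  have hk' : (1 : ℝ) ≤ k := by exact_mod_cast hk0
  have hx16 : 16 ≤ x := by nlinarith
  have hx : 0 < x := by linarith
  have hm0 : (0 : ℝ) < m := hmx ▸ Real.exp_pos x
  have hkx : (k : ℝ) ≤ x := by nlinarith
  have h2m : (2 : ℝ) ≤ Real.exp x := by
    have := Real.add_one_le_exp x
    linarith
  have h1 : (2 * m * m : ℝ) ^ k ≤ Real.exp (3 * x ^ 2) := by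
    calc (2 * m * m : ℝ) ^ k ≤ (Real.exp (3 * x)) ^ k := by
          refine pow_le_pow_left₀ (by positivity) ?_ k
          rw [hmx, show 3 * x = x + x + x by ring, Real.exp_add, Real.exp_add]
          exact mul_le_mul_of_nonneg_right (mul_le_mul_of_nonneg_right h2m (Real.exp_pos x).le)
            (Real.exp_pos x).le
      _ = Real.exp (k * (3 * x)) := (Real.exp_nat_mul _ _).symm
      _ ≤ _ := Real.exp_le_exp.mpr (by nlinarith)
  have hq : Real.exp (-(x / 4)) ≤ ((τ : ℝ) / m) ^ k := by
    have hb : Real.exp (-(2 * Real.log x)) ≤ (τ : ℝ) / m := by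
      have h3 : Real.exp (2 * Real.log x) = x ^ 2 := by
        rw [two_mul, Real.exp_add, Real.exp_log hx, sq]
      rw [Real.exp_neg, h3, inv_eq_one_div, div_le_div_iff₀ (by positivity) hm0, one_mul]
      have h4 : (m : ℝ) ≤ 128 * k ^ 2 * τ := by exact_mod_cast hτ
      have h5 : 128 * (k : ℝ) ^ 2 ≤ x ^ 2 := by
        have h6 : (k : ℝ) * 16 ≤ x := by nlinarith
        nlinarith
      calc (m : ℝ) ≤ 128 * k ^ 2 * τ := h4
        _ ≤ x ^ 2 * τ := mul_le_mul_of_nonneg_right h5 (by positivity)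
        _ = τ * x ^ 2 := mul_comm _ _
    calc Real.exp (-(x / 4)) ≤ Real.exp (k * (-(2 * Real.log x))) :=
          Real.exp_le_exp.mpr (by linarith)
      _ = Real.exp (-(2 * Real.log x)) ^ k := Real.exp_nat_mul _ _
      _ ≤ _ := pow_le_pow_left₀ (Real.exp_pos _).le hb k
  have hq1 : ((τ : ℝ) / m) ^ k ≤ 1 :=
    pow_le_one₀ (by positivity) (div_le_one_of_le₀ (by exact_mod_cast hτm) hm0.le)
  have hN : Real.exp (x / 2) / 2 ≤ Nat.sqrt m := by
    have h3 : m < (Nat.sqrt m + 1) * (Nat.sqrt m + 1) := Nat.lt_succ_sqrt m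
    have h4 : Real.exp (x / 2) * Real.exp (x / 2) <
        ((Nat.sqrt m : ℝ) + 1) * ((Nat.sqrt m : ℝ) + 1) := by
      rw [← Real.exp_add, add_halves, ← hmx]
      exact_mod_cast h3
    have h5 : Real.exp (x / 2) < Nat.sqrt m + 1 :=
      lt_of_mul_self_lt_mul_self₀ (by positivity) h4
    have h6 := Real.add_one_le_exp (x / 2)
    linarith
  have h2 : (1 - ((τ : ℝ) / m) ^ k) ^ Nat.sqrt m ≤ Real.exp (-(Real.exp (x / 4) / 2)) := by
    calc (1 - ((τ : ℝ) / m) ^ k) ^ Nat.sqrt m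
        ≤ Real.exp (-Real.exp (-(x / 4))) ^ Nat.sqrt m := by
          refine pow_le_pow_left₀ (by linarith) ?_ _
          have := Real.add_one_le_exp (-Real.exp (-(x / 4)))
          linarith
      _ = Real.exp (Nat.sqrt m * (-Real.exp (-(x / 4)))) := (Real.exp_nat_mul _ _).symm
      _ ≤ _ := by
          refine Real.exp_le_exp.mpr ?_
          have h3 := mul_le_mul_of_nonneg_right hN (Real.exp_pos (-(x / 4))).le
          have h4 : Real.exp (x / 2) * Real.exp (-(x / 4)) = Real.exp (x / 4) := by
            rw [← Real.exp_add]
            congr 1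
            ring
          linarith
  calc (2 * m * m : ℝ) ^ k * (1 - ((τ : ℝ) / m) ^ k) ^ Nat.sqrt m
      ≤ Real.exp (3 * x ^ 2) * Real.exp (-(Real.exp (x / 4) / 2)) :=
        mul_le_mul h1 h2 (pow_nonneg (by linarith) _) (Real.exp_pos _).le
    _ = Real.exp (3 * x ^ 2 - Real.exp (x / 4) / 2) := by rw [← Real.exp_add, sub_eq_add_neg]
    _ ≤ Real.exp (-1) := Real.exp_le_exp.mpr (by linarith)
    _ ≤ 1 / 2 := by
        rw [Real.exp_neg, inv_eq_one_div]
        have := Real.add_one_le_exp (1 : ℝ)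
        exact one_div_le_one_div_of_le two_pos (by linarith)

/-- From k! ≥ (k/e)^k: the size of k gives log k - 1 ≥ (log x)/2, hence k (log k - 1) ≥ 2x. -/
theorem sq_le_factorial {x : ℝ} {m k : ℕ} (hmx : (m : ℝ) = Real.exp x)
    (hx : 0 < x) (hlog : 2 ≤ Real.log x) (hk : 4 * x / Real.log x ≤ k) :
    m ^ 2 ≤ k.factorial := by
  have hl : 0 < Real.log x := by linarith
  have hy : 0 < 4 * x / Real.log x := by positivity
  have hk0 : (0 : ℝ) < k := hy.trans_le hk
  have h1 : Real.log x / 2 ≤ Real.log k - 1 := by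
    have h2 : Real.log (4 * x / Real.log x) ≤ Real.log k := Real.log_le_log hy hk
    rw [Real.log_div (by positivity) hl.ne', Real.log_mul (by norm_num) hx.ne'] at h2
    have h3 := Real.log_le_sub_one_of_pos (show 0 < Real.log x / 2 by positivity)
    rw [Real.log_div hl.ne' two_ne_zero] at h3
    have h4 : Real.log 4 = 2 * Real.log 2 := by
      rw [show (4 : ℝ) = 2 ^ 2 by norm_num, Real.log_pow]
      norm_num
    have h5 := Real.log_two_gt_d9
    linarith
  have h2 : 2 * x ≤ k * (Real.log k - 1) := by
    calc 2 * x = 4 * x / Real.log x * (Real.log x / 2) := by field_simp; norm_num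
      _ ≤ _ := mul_le_mul hk h1 (by positivity) hk0.le
  have h3 := Real.pow_div_factorial_le_exp (k : ℝ) hk0.le k
  have h4 : (m : ℝ) ^ 2 ≤ k.factorial := by
    have hf : (0 : ℝ) < k.factorial := by exact_mod_cast k.factorial_pos
    rw [div_le_iff₀ hf] at h3
    have h5 : (k : ℝ) ^ k = Real.exp (k * Real.log k) := by
      rw [Real.exp_nat_mul, Real.exp_log hk0]
    rw [h5] at h3
    have h6 : Real.exp (2 * x) * Real.exp k ≤ k.factorial * Real.exp k := by
      rw [← Real.exp_add, mul_comm (k.factorial : ℝ)]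
      exact (Real.exp_le_exp.mpr (by linarith)).trans h3
    have h7 := le_of_mul_le_mul_right h6 (Real.exp_pos _)
    rwa [hmx, sq, ← Real.exp_add, ← two_mul]
  exact_mod_cast h4

theorem le_average_of_growth {x : ℝ} {m n : ℕ} (hmx : (m : ℝ) = Real.exp x)
    (hlog : 2 ≤ Real.log x) (hlin : 16 * Real.log x ≤ x) (hpow : 2 ^ 20 * x ^ 6 ≤ Real.exp x)
    (hexp : 6 * x ^ 2 + 2 ≤ Real.exp (x / 4)) (hn : 2 * m - 1 ≤ n)
    (A : Equiv.Perm (Fin m) → SearchAlg n) (hA : ∀ p, (A p).Searches p) :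
    1 / 384 * ((n : ℝ) * x / (m * Real.log x)) ≤
      (∑ p : Equiv.Perm (Fin m), (A p).averageAccesses) / (m.factorial : ℝ) := by
  have hl : 0 < Real.log x := by linarith
  have hx : 0 < x := by linarith
  have hm0 : (0 : ℝ) < m := hmx ▸ Real.exp_pos x
  set y := x / (8 * Real.log x) with hy
  have hy2 : 2 ≤ y := by rw [hy, le_div_iff₀ (by positivity)]; linarith
  set k := ⌊y⌋₊ with hkdef
  have hky : (k : ℝ) ≤ y := Nat.floor_le (by linarith)
  have hyk : y / 2 ≤ k := by
    have := Nat.lt_floor_add_one y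
    rw [← hkdef] at this
    linarith
  have hk0 : 0 < k := by
    have : (0 : ℝ) < k := by linarith
    exact_mod_cast this
  have hkx8 : (k : ℝ) * (8 * Real.log x) ≤ x := by
    rw [hy, le_div_iff₀ (by positivity)] at hky
    exact hky
  have hkx : (k : ℝ) ≤ x := by nlinarith
  have hsq : (1024 * k ^ 3) * (1024 * k ^ 3) ≤ m := by
    have h1 : (k : ℝ) ^ 6 ≤ x ^ 6 := pow_le_pow_left₀ (by positivity) hkx 6
    have h2 : ((1024 * k ^ 3) * (1024 * k ^ 3) : ℝ) ≤ m := by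
      rw [hmx]
      calc ((1024 * k ^ 3) * (1024 * k ^ 3) : ℝ) = 2 ^ 20 * (k : ℝ) ^ 6 := by ring
        _ ≤ 2 ^ 20 * x ^ 6 := by linarith
        _ ≤ _ := hpow
    exact_mod_cast h2
  have hN : 1024 * k ^ 3 ≤ Nat.sqrt m := Nat.le_sqrt.mpr hsq
  have hNm : Nat.sqrt m * (1024 * k ^ 3) ≤ m :=
    (Nat.mul_le_mul_left _ hN).trans (Nat.sqrt_le m)
  have hk1 : 1 ≤ k ^ 2 := Nat.one_le_pow _ _ hk0
  have hk23 : k ^ 2 ≤ k ^ 3 := Nat.pow_le_pow_right hk0 (by norm_num)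
  have hk13 : k ≤ k ^ 3 := Nat.le_self_pow (by norm_num) k
  have hm3 : 1024 * k ^ 3 ≤ m := hN.trans (Nat.sqrt_le_self m)
  set N := Nat.sqrt m with hNdef
  set ε := m / (64 * k ^ 2) with hε
  have hεm : 64 * ε ≤ m := by
    have := Nat.mul_div_le m (64 * k ^ 2)
    rw [← hε] at this
    nlinarith
  have hεm' : m < 64 * k ^ 2 * (ε + 1) := Nat.lt_mul_div_succ m (by positivity)
  have hkN : 16 * (k * N) ≤ ε + 1 := by
    have h1 : 64 * k ^ 2 * (16 * (k * N)) ≤ 64 * k ^ 2 * (ε + 1) := by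
      refine le_trans (le_of_eq_of_le ?_ hNm) hεm'.le
      ring
    exact le_of_mul_le_mul_left h1 (by positivity)
  have hτ : m ≤ 128 * k ^ 2 * (ε + 1 - k * N) := by
    refine hεm'.le.trans ?_
    calc 64 * k ^ 2 * (ε + 1) ≤ 64 * k ^ 2 * (2 * (ε + 1 - k * N)) :=
          Nat.mul_le_mul_left _ (by omega)
      _ = _ := by ring
  obtain ⟨g, v, hg, hgm, hgn, hv⟩ := exists_segment_parameters hk0 hm3 hn
  have hhalf := pow_mul_one_sub_pow_le_half hmx hlog hexp hk0 hkx8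
    (show ε + 1 - k * N ≤ m by omega) hτ
  have hbad := card_not_flexible_le (m := m) (k := k) (ε := ε) (N := N) (τ := ε + 1 - k * N)
    (by
      refine le_trans (Nat.mul_le_mul_left _ ?_) hNm
      omega) hk0 (by omega) (by omega)
  have hmf : (0 : ℝ) ≤ m.factorial := by positivity
  have hmain := SearchAlg.le_sum_averageAccesses (k := k) (ε := ε) A hA hk0 (by omega) hn hg hgm
    hgn hv (hbad.trans (by nlinarith))
  refine le_trans ?_ hmain
  set q := n / (2 * m - 1) with hq
  have hqn : n ≤ 4 * m * q := by
    have h1 : 1 ≤ q := (Nat.one_le_div_iff (by omega)).mpr hn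
    have h2 : n < (2 * m - 1) * (q + 1) := Nat.lt_mul_div_succ n (by omega)
    have h3 : (2 * m - 1) * (q + 1) ≤ 2 * m * (2 * q) := Nat.mul_le_mul (by omega) (by omega)
    nlinarith
  have hqn' : (n : ℝ) / m ≤ 4 * q := by
    rw [div_le_iff₀ hm0]
    have : (n : ℝ) ≤ 4 * m * q := by exact_mod_cast hqn
    linarith
  -- 384 = 48 · 8: the 8 is in y, and 48 = 6 · 4 · 2 comes from the averaging, from n ≤ 4mq and from
  -- y ≤ 2k.
  calc 1 / 384 * ((n : ℝ) * x / (m * Real.log x)) = 1 / 48 * (n / m) * y := by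
        rw [hy]
        field_simp
        ring
    _ ≤ 1 / 48 * (4 * q) * (2 * k) := by gcongr; linarith
    _ = ((k * q : ℕ) : ℝ) / 6 := by push_cast; ring

theorem exists_average_le_of_growth {x : ℝ} {m n : ℕ} (hmx : (m : ℝ) = Real.exp x)
    (hlog : 2 ≤ Real.log x) (hlin : 16 * Real.log x ≤ x) (hpow : 2 ^ 20 * x ^ 6 ≤ Real.exp x)
    (hn : m ≤ n) (p : Equiv.Perm (Fin m)) :
    ∃ A : SearchAlg n, A.Searches p ∧
      A.averageAccesses ≤ 18 * ((n : ℝ) * x / (m * Real.log x)) := by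
  have hl : 0 < Real.log x := by linarith
  have hx : 32 ≤ x := by linarith
  have hm0 : (0 : ℝ) < m := hmx ▸ Real.exp_pos x
  set y := 4 * x / Real.log x with hy
  have hy2 : y ≤ 2 * x := by rw [hy, div_le_iff₀ hl]; nlinarith
  have hy4 : 4 ≤ y := by rw [hy, le_div_iff₀ hl]; linarith
  set k := ⌈y⌉₊ with hkdef
  have hyk : y ≤ k := Nat.le_ceil y
  have hky : (k : ℝ) < y + 1 := Nat.ceil_lt_add_one (by linarith)
  have hkm : 2 * (k + 1) ≤ m := by
    have h1 : x ≤ x ^ 6 := le_self_pow₀ (by linarith) (by norm_num)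
    have h2 : (2 * (k + 1) : ℝ) ≤ m := by rw [hmx]; linarith
    exact_mod_cast h2
  have hfact : m ^ 2 ≤ k.factorial := sq_le_factorial hmx (by linarith) hlog hyk
  have h2h : 2 * (m / 2) ≤ m := Nat.mul_div_le m 2
  have hh3 : m ≤ 3 * (m / 2) := by omega
  set h := m / 2 with hh
  obtain ⟨A, hA, hav⟩ := SearchAlg.exists_searches_averageAccesses_le (n := n) (h := h) (k := k) p
    (by omega) (by omega) hn (le_trans (by nlinarith) hfact)
  refine ⟨A, hA, hav.trans ?_⟩
  have hB : ((n - m) / h + 1) * m ≤ 3 * n := by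
    have h1 := Nat.div_mul_le_self (n - m) h
    calc ((n - m) / h + 1) * m ≤ ((n - m) / h + 1) * (3 * h) := Nat.mul_le_mul_left _ hh3
      _ = 3 * ((n - m) / h * h + h) := by ring
      _ ≤ _ := Nat.mul_le_mul_left _ (by omega)
  have hB' : (((n - m) / h + 1 : ℕ) : ℝ) ≤ 3 * (n / m) := by
    rw [← mul_div_assoc, le_div_iff₀ hm0]
    exact_mod_cast hB
  rw [Nat.cast_mul]
  -- k + 1 ≤ y + 2 ≤ 3y/2 since y ≥ 4; with y = 4x / log x the constant is 3 · 3/2 · 4 = 18.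
  calc (((n - m) / h + 1 : ℕ) : ℝ) * ((k + 1 : ℕ) : ℝ) ≤ 3 * (n / m) * (3 / 2 * y) := by
        refine mul_le_mul hB' ?_ (by positivity) (by positivity)
        push_cast
        linarith
    _ = 18 * ((n : ℝ) * x / (m * Real.log x)) := by
        rw [hy]
        field_simp
        ring

theorem mainTheorem3 :
    ∃ (c C : ℝ) (m₀ : ℕ), 0 < c ∧ 0 < C ∧
      (∀ m n : ℕ, m₀ ≤ m → 2 * m - 1 ≤ n →
        ∀ A : Equiv.Perm (Fin m) → SearchAlg n, (∀ p, (A p).Searches p) →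
          c * ((n : ℝ) * Real.log m / ((m : ℝ) * Real.log (Real.log m))) ≤
            (∑ p : Equiv.Perm (Fin m), (A p).averageAccesses) / (m.factorial : ℝ)) ∧
      (∀ m n : ℕ, m₀ ≤ m → m ≤ n →
        ∃ A : Equiv.Perm (Fin m) → SearchAlg n, ∀ p : Equiv.Perm (Fin m),
          (A p).Searches p ∧
            (A p).averageAccesses ≤
              C * ((n : ℝ) * Real.log m / ((m : ℝ) * Real.log (Real.log m)))) := by
  obtain ⟨m₀, hm₀⟩ := Filter.eventually_atTop.mp
    ((Real.tendsto_log_atTop.comp tendsto_natCast_atTop_atTop).eventually eventually_atTop_growth)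
  simp only [Function.comp_apply] at hm₀
  have hexp : ∀ m : ℕ, max m₀ 1 ≤ m → (m : ℝ) = Real.exp (Real.log m) := fun m hm =>
    (Real.exp_log (by exact_mod_cast (le_max_right m₀ 1).trans hm)).symm
  refine ⟨1 / 384, 18, max m₀ 1, by norm_num, by norm_num, ?_, ?_⟩
  · intro m n hm hn A hA
    obtain ⟨h1, h2, h3, h4⟩ := hm₀ m ((le_max_left _ _).trans hm)
    exact le_average_of_growth (hexp m hm) h1 h2 h3 h4 hn A hA
  · intro m n hm hn
    obtain ⟨h1, h2, h3, -⟩ := hm₀ m ((le_max_left _ _).trans hm)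
    choose A hA using exists_average_le_of_growth (n := n) (hexp m hm) h1 h2 h3 hn
    exact ⟨A, hA⟩
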